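/- Let $n\ge 2$ and let $(X,J,g,\omega)$ be a compact almost-Hermitian manifold of real dimension $2n$: $J$ is a smooth almost complex structure, $g$ a smooth Riemannian metric with $g(J\cdot,J\cdot)=g$, and $\omega=g(J\cdot,\cdot)$. Let $A^{p,q}$ be the space of smooth complex forms of bidegree $(p,q)$, and let $\partial$ and $\bar\partial$ be the operators that on $A^{p,q}$ are the $(p+1,q)$- and the $(p,q+1)$-component of the exterior derivative $d$. Let $*$ be the $\mathbb C$-linear Hodge star of $g$ (with the orientation induced by $J$), $\partial^*=-*\bar\partial*$, $\bar\partial^*=-*\partial*$, and $$\mathcal H^{p,q}_{\partial}=\{\alpha\in A^{p,q}:(\partial\partial^*+\partial^*\partial)\alpha=0\},\qquad \mathcal H^{p,q}_{\bar\partial}=\{\alpha\in A^{p,q}:(\bar\partial\bar\partial^*+\bar\partial^*\bar\partial)\alpha=0\}.$$ Let $L\alpha=\omega\wedge\alpha$, $\Lambda=-*L*$, and let $P^{p,q}=\{\alpha\in A^{p,q}:\Lambda\alpha=0\}$ be the space of primitive $(p,q)$-forms. Then for all integers $0\le p,q\le n$ $$\mathcal H^{n,n-p}_{\bar\partial}=L^{n-p}\bigl(\mathcal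 H^{p,0}_{\partial}\cap P^{p,0}\bigr),\qquad \mathcal H^{n-q,n}_{\bar\partial}=L^{n-q}\bigl(\mathcal H^{0,q}_{\partial}\cap P^{0,q}\bigr),$$ $$\mathcal H^{n,n-p}_{\partial}=L^{n-p}\bigl(\mathcal H^{p,0}_{\bar\partial}\cap P^{p,0}\bigr),\qquad \mathcal H^{n-q,n}_{\partial}=L^{n-q}\bigl(\mathcal H^{0,q}_{\bar\partial}\cap P^{0,q}\bigr).$$ -/

import Mathlib

open scoped Manifold ContDiff
open Bundle

noncomputable section

namespace AlmostHermitian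

/-! ### Linear algebra on one real vector space with a complex structure -/

section Pointwise

variable {V : Type*} [AddCommGroup V] [Module ℝ V] [TopologicalSpace V]

/-- The wedge product `θ₀ ∧ ⋯ ∧ θ_{k-1}` of complex-valued real covectors, that is, the
alternating form `(v_b) ↦ det (θ_a (v_b)) = ∑ σ, sign σ * ∏ a, θ_a (v_{σ a})`. -/
def covectorWedge {k : ℕ} (θ : Fin k → V →L[ℝ] ℂ) : V [⋀^Fin k]→L[ℝ] ℂ :=
  ContinuousMultilinearMap.alternatization
    ((ContinuousMultilinearMap.mkPiAlgebra ℝ (Fin k) ℂ).compContinuousLinearMap θ)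

theorem covectorWedge_apply {k : ℕ} (θ : Fin k → V →L[ℝ] ℂ) (v : Fin k → V) :
    covectorWedge θ v = (Matrix.of fun a b => θ a (v b)).det := by
  simp only [covectorWedge, ContinuousMultilinearMap.alternatization_apply_apply]
  rw [← Matrix.det_transpose, Matrix.det_apply]
  simp [Matrix.transpose_apply]

/-- The product `(v₀, …, v_{m-1}) ↦ a (v₀, …, v_{k-1}) * b (v_k, …, v_{m-1})`, with `k + l = m`. -/
def tensorMul {k l m : ℕ} (h : k + l = m) (a : V [⋀^Fin k]→L[ℝ] ℂ) (b : V [⋀^Fin l]→L[ℝ] ℂ) :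
    ContinuousMultilinearMap ℝ (fun _ : Fin m => V) ℂ where
  toFun v := a (fun i => v (Fin.cast h (Fin.castAdd l i))) *
    b (fun j => v (Fin.cast h (Fin.natAdd k j)))
  map_update_add' := by
    subst h
    intro inst v i x y
    refine Fin.addCases (fun i => ?_) (fun j => ?_) i
    · have h1 : ∀ z : V, (fun i' : Fin k => Function.update v (Fin.castAdd l i) z
          (Fin.castAdd l i')) = Function.update (fun i' => v (Fin.castAdd l i')) i z := fun z => by
        ext i'; simp [Function.update_apply]
      have h2 : ∀ z : V, (fun j' : Fin l => Function.update v (Fin.castAdd l i) z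
          (Fin.natAdd k j')) = fun j' => v (Fin.natAdd k j') := fun z => by
        ext j'; rw [Function.update_of_ne]; simp [Fin.ext_iff]; omega
      simp [h1, h2, add_mul]
    · have h1 : ∀ z : V, (fun j' : Fin l => Function.update v (Fin.natAdd k j) z
          (Fin.natAdd k j')) = Function.update (fun j' => v (Fin.natAdd k j')) j z := fun z => by
        ext j'; simp [Function.update_apply]
      have h2 : ∀ z : V, (fun i' : Fin k => Function.update v (Fin.natAdd k j) z
          (Fin.castAdd l i')) = fun i' => v (Fin.castAdd l i') := fun z => by
        ext i'; rw [Function.update_of_ne]; simp [Fin.ext_iff]; omega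
      simp [h1, h2, mul_add]
  map_update_smul' := by
    subst h
    intro inst v i c x
    refine Fin.addCases (fun i => ?_) (fun j => ?_) i
    · have h1 : ∀ z : V, (fun i' : Fin k => Function.update v (Fin.castAdd l i) z
          (Fin.castAdd l i')) = Function.update (fun i' => v (Fin.castAdd l i')) i z := fun z => by
        ext i'; simp [Function.update_apply]
      have h2 : ∀ z : V, (fun j' : Fin l => Function.update v (Fin.castAdd l i) z
          (Fin.natAdd k j')) = fun j' => v (Fin.natAdd k j') := fun z => by
        ext j'; rw [Function.update_of_ne]; simp [Fin.ext_iff]; omega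
      simp [h1, h2, mul_assoc]
    · have h1 : ∀ z : V, (fun j' : Fin l => Function.update v (Fin.natAdd k j) z
          (Fin.natAdd k j')) = Function.update (fun j' => v (Fin.natAdd k j')) j z := fun z => by
        ext j'; simp [Function.update_apply]
      have h2 : ∀ z : V, (fun i' : Fin k => Function.update v (Fin.natAdd k j) z
          (Fin.castAdd l i')) = fun i' => v (Fin.castAdd l i') := fun z => by
        ext i'; rw [Function.update_of_ne]; simp [Fin.ext_iff]; omega
      simp [h1, h2, mul_left_comm]
  cont := (a.cont.comp (by fun_prop)).mul (b.cont.comp (by fun_prop))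

/-- The wedge product of alternating forms,
`(a ∧ b)(v) = 1 / (k! l!) * ∑ σ, sign σ * a (v_{σ 0}, …) * b (v_{σ k}, …)`, with `k + l = m`. -/
def wedge {k l m : ℕ} (h : k + l = m) (a : V [⋀^Fin k]→L[ℝ] ℂ) (b : V [⋀^Fin l]→L[ℝ] ℂ) :
    V [⋀^Fin m]→L[ℝ] ℂ :=
  ((k.factorial * l.factorial : ℂ)⁻¹) •
    ContinuousMultilinearMap.alternatization (tensorMul h a b)

/-- The `2`-form `(u, v) ↦ B u v` of a continuous bilinear form with `B v v = 0`. -/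
def twoForm (B : V →L[ℝ] V →L[ℝ] ℝ) (hc : Continuous fun w : V × V => B w.1 w.2)
    (h0 : ∀ v, B v v = 0) : V [⋀^Fin 2]→L[ℝ] ℂ where
  toFun v := (B (v 0) (v 1) : ℂ)
  map_update_add' v i x y := by
    fin_cases i <;> simp
  map_update_smul' v i c x := by
    fin_cases i <;> simp
  map_eq_zero_of_eq' v i j h hij := by
    fin_cases i <;> fin_cases j <;> simp_all
  cont := Complex.continuous_ofReal.comp
    (hc.comp (f := fun v : Fin 2 → V => (v 0, v 1)) (by fun_prop))

/-- The forms of bidegree `(p, q)` (and degree `k = p + q`) with respect to the complex structure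
`J`: the complex span of the wedge products of `p` covectors of type `(1, 0)`
(`θ ∘ J = i θ`) and `q` covectors of type `(0, 1)` (`θ ∘ J = -i θ`). -/
def typeForms (J : V →L[ℝ] V) (p q k : ℕ) : Submodule ℂ (V [⋀^Fin k]→L[ℝ] ℂ) :=
  Submodule.span ℂ {α | ∃ (S : Finset (Fin k)) (θ : Fin k → V →L[ℝ] ℂ),
    S.card = p ∧ Sᶜ.card = q ∧
    (∀ a ∈ S, ∀ v, θ a (J v) = Complex.I * θ a v) ∧
    (∀ a ∉ S, ∀ v, θ a (J v) = -Complex.I * θ a v) ∧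
    α = covectorWedge θ}

/-- A unitary frame `e₀, J e₀, e₂, J e₂, …` of a `2n`-dimensional space: it is orthonormal for `g`
and positively oriented for the orientation given by `J`. -/
def IsUnitaryFrame {n : ℕ} (J : V →L[ℝ] V) (g : V →L[ℝ] V →L[ℝ] ℝ) (e : Fin (2 * n) → V) : Prop :=
  (∀ a b, g (e a) (e b) = if a = b then 1 else 0) ∧
    ∀ j : Fin n, e ⟨2 * j + 1, by omega⟩ = J (e ⟨2 * j, by omega⟩)

theorem exists_isUnitaryFrame {n : ℕ} {J : V →L[ℝ] V} {g : V →L[ℝ] V →L[ℝ] ℝ}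
    (hdim : Module.finrank ℝ V = 2 * n) (hJ : ∀ v, J (J v) = -v)
    (hsymm : ∀ u v, g u v = g v u) (hpos : ∀ v, v ≠ 0 → 0 < g v v)
    (hgJ : ∀ u v, g (J u) (J v) = g u v) :
    ∃ e : Fin (2 * n) → V, IsUnitaryFrame J g e := by
  suffices H : ∀ k ≤ n, ∃ e : Fin (2 * k) → V, IsUnitaryFrame J g e from H n le_rfl
  intro k
  induction k with
  | zero => exact fun _ => ⟨fun i => absurd i.2 (by omega), fun a => absurd a.2 (by omega),
      fun j => absurd j.2 (by omega)⟩
  | succ k ih =>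
    intro hk
    obtain ⟨e, he, heJ⟩ := ih (by omega)
    let T : V →ₗ[ℝ] (Fin (2 * k) → ℝ) := LinearMap.pi fun a => (g (e a)).toLinearMap
    have : Module.Finite ℝ V := Module.finite_of_finrank_pos (by omega)
    have hker : LinearMap.ker T ≠ ⊥ := LinearMap.ker_ne_bot_of_finrank_lt (by simp [hdim]; omega)
    obtain ⟨w, hw, hw0⟩ := (Submodule.ne_bot_iff _).1 hker
    have hwe : ∀ a, g (e a) w = 0 := fun a => congrFun (LinearMap.mem_ker.1 hw) a
    have hww := hpos w hw0
    set u : V := (Real.sqrt (g w w))⁻¹ • w with hu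
    have huu : g u u = 1 := by
      have := Real.mul_self_sqrt hww.le
      have h0 : Real.sqrt (g w w) ≠ 0 := (Real.sqrt_pos.2 hww).ne'
      simp only [hu, map_smul, smul_apply, smul_eq_mul]
      field_simp
      rw [sq, this]
    have hue : ∀ a, g (e a) u = 0 := fun a => by simp [hu, hwe]
    have hJue : ∀ a, g (e a) (J u) = 0 := by
      intro a
      obtain ⟨a, ha⟩ := a
      obtain ⟨j, rfl | rfl⟩ : ∃ j, a = 2 * j ∨ a = 2 * j + 1 := ⟨a / 2, by omega⟩
      · have h1 := heJ ⟨j, by omega⟩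
        have h2 : e ⟨2 * j, ha⟩ = -J (e ⟨2 * j + 1, by omega⟩) := by
          rw [h1, hJ]; simp
        rw [h2]
        simp [hgJ, hue]
      · have h1 := heJ ⟨j, by omega⟩
        simp only at h1
        rw [h1, hgJ, hue]
    have huJ : g u (J u) = 0 := by
      have h1 := hgJ u (J u)
      rw [hJ, map_neg, hsymm (J u) u] at h1
      linarith
    refine ⟨fun a => if h : (a : ℕ) < 2 * k then e ⟨a, h⟩ else if (a : ℕ) = 2 * k then u else J u,
      fun a b => ?_, fun j => ?_⟩
    · have hab : a = b ↔ (a : ℕ) = b := Fin.ext_iff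
      have ha := a.2
      have hb := b.2
      simp only [hab]
      by_cases h1 : (a : ℕ) < 2 * k <;> by_cases h2 : (b : ℕ) < 2 * k
      · simp [h1, h2, he]
      · have : (a : ℕ) ≠ b := by omega
        by_cases h3 : (b : ℕ) = 2 * k <;> simp [h1, h2, h3, hue, hJue, this] <;> omega
      · have : (a : ℕ) ≠ b := by omega
        by_cases h3 : (a : ℕ) = 2 * k
        · simp only [h2, h3, lt_irrefl, dif_pos, dif_neg, if_true, not_false_eq_true]
          rw [hsymm, hue, if_neg (by omega)]
        · simp only [h1, h2, h3, dif_pos, dif_neg, if_false, not_false_eq_true]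
          rw [hsymm, hJue, if_neg (by omega)]
      · by_cases h3 : (a : ℕ) = 2 * k <;> by_cases h4 : (b : ℕ) = 2 * k
        · simp [h3, h4, huu]
        · simp only [h2, h3, h4, dif_neg, if_false, if_true, not_false_eq_true]
          rw [if_neg (by omega)]; simp [huJ]
        · simp only [h1, h3, h4, dif_neg, if_false, if_true, not_false_eq_true]
          rw [hsymm]; simp [huJ]
        · simp only [h1, h2, h3, h4, dif_neg, if_false, not_false_eq_true]
          rw [if_pos (by omega), hgJ, huu]
    · by_cases h1 : (j : ℕ) < k
      · have h2 : 2 * (j : ℕ) < 2 * k := by omega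
        have h3 : 2 * (j : ℕ) + 1 < 2 * k := by omega
        simp only [h2, h3, dif_pos]
        exact heJ ⟨j, h1⟩
      · have hj := j.2
        have h2 : (j : ℕ) = k := by omega
        simp [h2]

/-- The complex-linear Hodge star on `k`-forms, `k + m = 2n`, computed in a unitary frame `e` with
dual frame `e^0, …, e^{2n-1}`: it maps `e^{i_1} ∧ ⋯ ∧ e^{i_k}` to `e^{j_1} ∧ ⋯ ∧ e^{j_m}` whenever
`(i_1, …, i_k, j_1, …, j_m)` is an even permutation of `(0, …, 2n-1)`. Indeed
`*α = 1 / (k! m!) * ∑ σ, sign σ * α (e_{σ 0}, …, e_{σ (k-1)}) e^{σ k} ∧ ⋯ ∧ e^{σ (2n-1)}`. -/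
def frameStar {n k m : ℕ} (h : k + m = 2 * n) (g : V →L[ℝ] V →L[ℝ] ℝ) (e : Fin (2 * n) → V)
    (α : V [⋀^Fin k]→L[ℝ] ℂ) : V [⋀^Fin m]→L[ℝ] ℂ :=
  ((k.factorial * m.factorial : ℂ)⁻¹) • ∑ σ : Equiv.Perm (Fin (2 * n)),
    (((Equiv.Perm.sign σ : ℤ) : ℂ) * α (fun i => e (σ (Fin.cast h (Fin.castAdd m i))))) •
      covectorWedge fun j =>
        Complex.ofRealCLM.comp (g (e (σ (Fin.cast h (Fin.natAdd k j)))))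

section Types

variable [IsTopologicalAddGroup V] [ContinuousSMul ℝ V]

/-- Multiplication by `e^{it}` on `V`, where `i` acts as `J`. -/
def rotation (J : V →L[ℝ] V) (t : ℝ) : V →L[ℝ] V :=
  Real.cos t • ContinuousLinearMap.id ℝ V + Real.sin t • J

/-- The projection of `k`-forms to their component of bidegree `(p, q)`, `p + q = k`, for the
decomposition `Λ^k = ⨁_{p+q=k} Λ^{p,q}`. As `e^{it}` acts on `Λ^{p,q}` by `e^{it(p-q)}`, it is the
average of `e^{-it(p-q)} (e^{it})^* α` over the `(2k+1)`-st roots of unity `e^{it}`.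
The lemmas `typeProj_mem`, `sum_typeProj`, `typeProj_of_mem` and `typeProj_of_mem_of_ne` below show
that this is that projection. -/
def typeProj (J : V →L[ℝ] V) (p q : ℕ) {k : ℕ} (α : V [⋀^Fin k]→L[ℝ] ℂ) :
    V [⋀^Fin k]→L[ℝ] ℂ :=
  if p + q = k then
    ((2 * k + 1 : ℂ)⁻¹) • ∑ j ∈ Finset.range (2 * k + 1),
      Complex.exp (-(2 * Real.pi * j / (2 * k + 1) * ((p : ℂ) - q) * Complex.I)) •
        α.compContinuousLinearMap (rotation J (2 * Real.pi * j / (2 * k + 1)))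
  else 0

theorem typeProj_add (J : V →L[ℝ] V) (p q : ℕ) {k : ℕ} (α β : V [⋀^Fin k]→L[ℝ] ℂ) :
    typeProj J p q (α + β) = typeProj J p q α + typeProj J p q β := by
  unfold typeProj
  split_ifs
  · ext v
    simp [mul_add, Finset.sum_add_distrib]
  · exact (add_zero (0 : V [⋀^Fin k]→L[ℝ] ℂ)).symm

theorem typeProj_smul (J : V →L[ℝ] V) (p q : ℕ) {k : ℕ} (c : ℂ) (α : V [⋀^Fin k]→L[ℝ] ℂ) :
    typeProj J p q (c • α) = c • typeProj J p q α := by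
  unfold typeProj
  split_ifs
  · ext v
    simp only [ContinuousAlternatingMap.smul_apply, ContinuousAlternatingMap.sum_apply,
      ContinuousAlternatingMap.compContinuousLinearMap_apply, smul_eq_mul, Finset.mul_sum]
    refine Finset.sum_congr rfl fun _ _ => by ring
  · ext v
    simp

/-- `e^{it}` acts on forms of bidegree `(p, q)` by `e^{it(p-q)}`. -/
theorem comp_rotation_of_mem {J : V →L[ℝ] V} {p q k : ℕ} {α : V [⋀^Fin k]→L[ℝ] ℂ}
    (hα : α ∈ typeForms J p q k) (t : ℝ) :
    α.compContinuousLinearMap (rotation J t) =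
      Complex.exp (t * ((p : ℂ) - q) * Complex.I) • α := by
  induction hα using Submodule.span_induction with
  | mem α h =>
    obtain ⟨S, θ, rfl, rfl, h1, h2, rfl⟩ := h
    ext v
    have key : ∀ a b, θ a (rotation J t (v b)) =
        (if a ∈ S then Complex.exp (t * Complex.I) else Complex.exp (-(t * Complex.I))) *
          θ a (v b) := by
      intro a b
      have e1 : θ a (rotation J t (v b)) =
          (Real.cos t : ℂ) * θ a (v b) + (Real.sin t : ℂ) * θ a (J (v b)) := by
        simp [rotation]
      rw [e1]
      split_ifs with ha
      · rw [h1 a ha, Complex.exp_mul_I]; push_cast; ring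
      · rw [h2 a ha, show -((t : ℂ) * Complex.I) = (-(t : ℂ)) * Complex.I by ring,
          Complex.exp_mul_I, Complex.cos_neg, Complex.sin_neg]; push_cast; ring
    simp only [ContinuousAlternatingMap.compContinuousLinearMap_apply,
      ContinuousAlternatingMap.smul_apply, covectorWedge_apply, Function.comp_apply, key]
    rw [show (Matrix.of fun a b => (if a ∈ S then Complex.exp (t * Complex.I)
        else Complex.exp (-(t * Complex.I))) * θ a (v b)) =
        Matrix.of fun a b => (if a ∈ S then Complex.exp (t * Complex.I)
        else Complex.exp (-(t * Complex.I))) * (Matrix.of fun a b => θ a (v b)) a b from rfl,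
      Matrix.det_mul_column, smul_eq_mul]
    congr 1
    rw [Finset.prod_ite]
    simp only [Finset.prod_const, ← Complex.exp_nat_mul, ← Complex.exp_add]
    have c1 : (Finset.univ.filter fun a => a ∈ S) = S := by ext; simp
    have c2 : (Finset.univ.filter fun a => a ∉ S) = Sᶜ := by ext; simp
    rw [c1, c2]
    congr 1
    ring
  | zero => ext v; simp
  | add α β _ _ hα hβ =>
    ext v
    have h1 := congrArg (fun f => f v) hα
    have h2 := congrArg (fun f => f v) hβ
    simp only [ContinuousAlternatingMap.compContinuousLinearMap_apply,
      ContinuousAlternatingMap.smul_apply, ContinuousAlternatingMap.add_apply, smul_eq_mul]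
      at h1 h2 ⊢
    rw [h1, h2]; ring
  | smul c α _ hα =>
    ext v
    have := congrArg (fun f => f v) hα
    simp only [ContinuousAlternatingMap.compContinuousLinearMap_apply,
      ContinuousAlternatingMap.smul_apply, smul_eq_mul] at this ⊢
    rw [this]; ring

theorem typeProj_zero (J : V →L[ℝ] V) (p q k : ℕ) :
    typeProj J p q (0 : V [⋀^Fin k]→L[ℝ] ℂ) = 0 := by
  unfold typeProj
  split_ifs
  · ext v
    simp
  · rfl

theorem typeForms_eq_bot {J : V →L[ℝ] V} {p q k : ℕ} (h : p + q ≠ k) :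
    typeForms J p q k = ⊥ := by
  rw [typeForms, Submodule.span_eq_bot]
  rintro _ ⟨S, θ, rfl, rfl, -⟩
  exact absurd (by simp) h

theorem typeProj_of_mem {J : V →L[ℝ] V} {p q k : ℕ} (h : p + q = k) {α : V [⋀^Fin k]→L[ℝ] ℂ}
    (hα : α ∈ typeForms J p q k) : typeProj J p q α = α := by
  rw [typeProj, if_pos h]
  have h1 : ∀ j ∈ Finset.range (2 * k + 1),
      Complex.exp (-(2 * Real.pi * j / (2 * k + 1) * ((p : ℂ) - q) * Complex.I)) •
        α.compContinuousLinearMap (rotation J (2 * Real.pi * j / (2 * k + 1))) = α := by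
    intro j _
    rw [comp_rotation_of_mem hα, smul_smul, ← Complex.exp_add]
    push_cast
    simp
  rw [Finset.sum_congr rfl h1, Finset.sum_const, Finset.card_range, ← Nat.cast_smul_eq_nsmul ℂ,
    smul_smul]
  have : (2 * k + 1 : ℂ) ≠ 0 := by exact_mod_cast Nat.succ_ne_zero (2 * k)
  push_cast
  rw [inv_mul_cancel₀ this, one_smul]

theorem typeProj_of_mem_of_ne {J : V →L[ℝ] V} {p q p' q' k : ℕ} (hne : (p, q) ≠ (p', q'))
    {α : V [⋀^Fin k]→L[ℝ] ℂ} (hα : α ∈ typeForms J p' q' k) : typeProj J p q α = 0 := by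
  by_cases h' : p' + q' = k
  swap
  · rw [typeForms_eq_bot h', Submodule.mem_bot] at hα
    subst hα
    exact typeProj_zero J p q k
  rw [typeProj]
  split_ifs with h
  swap
  · rfl
  have hN : (2 * k + 1 : ℂ) ≠ 0 := by exact_mod_cast Nat.succ_ne_zero (2 * k)
  set ζ : ℂ := Complex.exp (2 * Real.pi * Complex.I * (((p' : ℂ) - q' - (p - q)) / (2 * k + 1)))
    with hζ
  have h1 : ∀ j ∈ Finset.range (2 * k + 1),
      Complex.exp (-(2 * Real.pi * j / (2 * k + 1) * ((p : ℂ) - q) * Complex.I)) •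
        α.compContinuousLinearMap (rotation J (2 * Real.pi * j / (2 * k + 1))) = ζ ^ j • α := by
    intro j _
    rw [comp_rotation_of_mem hα, smul_smul, ← Complex.exp_add, hζ, ← Complex.exp_nat_mul]
    push_cast
    congr 2
    field_simp
    ring
  have hζN : ζ ^ (2 * k + 1) = 1 := by
    rw [hζ, ← Complex.exp_nat_mul, Complex.exp_eq_one_iff]
    refine ⟨(p' : ℤ) - q' - (p - q), ?_⟩
    push_cast
    field_simp
  have hζ1 : ζ ≠ 1 := by
    intro h0
    rw [hζ, Complex.exp_eq_one_iff] at h0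
    obtain ⟨r, hr⟩ := h0
    have hpi : (2 * Real.pi * Complex.I : ℂ) ≠ 0 := Complex.two_pi_I_ne_zero
    have h2 : ((p' : ℂ) - q' - (p - q)) = r * (2 * k + 1) := by
      rw [mul_comm (r : ℂ)] at hr
      have := mul_left_cancel₀ hpi hr
      rwa [div_eq_iff hN] at this
    have h3 : ((p' : ℤ) - q' - (p - q)) = r * (2 * k + 1) := by exact_mod_cast h2
    have h4 : (p : ℤ) ≠ p' := by
      rintro h5
      apply hne
      have : p = p' := by exact_mod_cast h5
      ext <;> simp <;> omega
    have h5 : (p' : ℤ) - q' - (p - q) = 2 * (p' - p) := by omega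
    rw [h5] at h3
    have h6 : r = 0 := by
      by_contra hr0
      rcases lt_or_gt_of_ne hr0 with hlt | hlt
      · have : r * (2 * (k : ℤ) + 1) ≤ (-1) * (2 * k + 1) :=
          mul_le_mul_of_nonneg_right (by omega) (by omega)
        omega
      · have : 1 * (2 * (k : ℤ) + 1) ≤ r * (2 * k + 1) :=
          mul_le_mul_of_nonneg_right (by omega) (by omega)
        omega
    rw [h6] at h3
    omega
  rw [Finset.sum_congr rfl h1, ← Finset.sum_smul]
  have h7 : ∑ j ∈ Finset.range (2 * k + 1), ζ ^ j = 0 := by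
    have := mul_geom_sum ζ (2 * k + 1)
    rw [hζN, sub_self] at this
    exact (mul_eq_zero.1 this).resolve_left (sub_ne_zero.2 hζ1)
  rw [h7]
  simp

theorem covectorWedge_mem_iSup {J : V →L[ℝ] V} (hJ : ∀ v, J (J v) = -v) {k : ℕ}
    (θ : Fin k → V →L[ℝ] ℂ) :
    covectorWedge θ ∈ ⨆ pq ∈ Finset.HasAntidiagonal.antidiagonal k, typeForms J pq.1 pq.2 k := by
  classical
  let c : ℂ → Fin k → V →L[ℝ] ℂ := fun s a =>
    (1 / 2 : ℂ) • (θ a + s • (θ a).comp J)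
  have hc : ∀ s a v, c s a v = 1 / 2 * (θ a v + s * θ a (J v)) := fun s a v => by simp [c, mul_add]
  have hsum : covectorWedge θ = ∑ S ∈ (Finset.univ : Finset (Fin k)).powerset,
      covectorWedge (S.piecewise (c (-Complex.I)) (c Complex.I)) := by
    ext v
    simp only [ContinuousAlternatingMap.sum_apply, covectorWedge,
      ContinuousMultilinearMap.alternatization_apply_apply,
      ContinuousMultilinearMap.compContinuousLinearMap_apply,
      ContinuousMultilinearMap.mkPiAlgebra_apply]
    rw [Finset.sum_comm]
    refine Finset.sum_congr rfl fun σ _ => ?_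
    rw [← Finset.smul_sum]
    congr 1
    have h1 : ∀ a, θ a ((v ∘ σ) a) =
        c (-Complex.I) a ((v ∘ σ) a) + c Complex.I a ((v ∘ σ) a) := fun a => by
      rw [hc, hc]; ring
    simp only [h1]
    rw [Finset.prod_add]
    refine Finset.sum_congr rfl fun S _ => ?_
    have h2 : ∀ a, (S.piecewise (c (-Complex.I)) (c Complex.I)) a ((v ∘ σ) a) =
        S.piecewise (fun a => c (-Complex.I) a ((v ∘ σ) a)) (fun a => c Complex.I a ((v ∘ σ) a))
          a := fun a => by
      by_cases ha : a ∈ S <;> simp [ha]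
    simp only [h2]
    rw [Finset.prod_piecewise]
    simp
  rw [hsum]
  refine Submodule.sum_mem _ fun S _ => ?_
  refine Submodule.mem_iSup_of_mem (S.card, Sᶜ.card) (Submodule.mem_iSup_of_mem ?_ ?_)
  · simp
  · refine Submodule.subset_span ⟨S, _, rfl, rfl, fun a ha v => ?_, fun a ha v => ?_, rfl⟩
    · simp only [Finset.piecewise_eq_of_mem _ _ _ ha, hc, hJ, map_neg]
      linear_combination (1 / 2 : ℂ) * θ a (J v) * Complex.I_mul_I
    · simp only [Finset.piecewise_eq_of_notMem _ _ _ ha, hc, hJ, map_neg]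
      linear_combination (1 / 2 : ℂ) * θ a (J v) * Complex.I_mul_I

/-- `Λ^k` is the sum of the `Λ^{p,q}` with `p + q = k`. -/
theorem iSup_typeForms [T2Space V] [FiniteDimensional ℝ V] {J : V →L[ℝ] V}
    (hJ : ∀ v, J (J v) = -v) (k : ℕ) :
    ⨆ pq ∈ Finset.HasAntidiagonal.antidiagonal k, typeForms J pq.1 pq.2 k = ⊤ := by
  classical
  rw [eq_top_iff]
  rintro α -
  let b := Module.finBasis ℝ V
  let β : Fin (Module.finrank ℝ V) → V →L[ℝ] ℂ := fun i =>
    Complex.ofRealCLM.comp (LinearMap.toContinuousLinearMap (b.coord i))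
  have hα : α = ((k.factorial : ℂ)⁻¹) • ∑ i : Fin k → Fin (Module.finrank ℝ V),
      α (fun a => b (i a)) • covectorWedge fun a => β (i a) := by
    ext v
    have hv : ∀ w : Fin k → V, α w = ∑ i : Fin k → Fin (Module.finrank ℝ V),
        α (fun a => b (i a)) * ∏ a, β (i a) (w a) := by
      intro w
      conv_lhs => rw [show w = fun a => ∑ j, b.repr (w a) j • b j from
        funext fun a => (b.sum_repr (w a)).symm]
      rw [ContinuousAlternatingMap.map_sum]
      refine Finset.sum_congr rfl fun i _ => ?_
      rw [ContinuousAlternatingMap.map_smul_univ]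
      simp [β, mul_comm]
    have hfac : (k.factorial : ℂ) ≠ 0 := by exact_mod_cast k.factorial_ne_zero
    simp only [ContinuousAlternatingMap.smul_apply, ContinuousAlternatingMap.sum_apply,
      covectorWedge, ContinuousMultilinearMap.alternatization_apply_apply,
      ContinuousMultilinearMap.compContinuousLinearMap_apply,
      ContinuousMultilinearMap.mkPiAlgebra_apply, smul_eq_mul]
    rw [eq_inv_mul_iff_mul_eq₀ hfac]
    simp only [Finset.mul_sum]
    rw [Finset.sum_comm]
    have hσ : ∀ σ ∈ (Finset.univ : Finset (Equiv.Perm (Fin k))),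
        (∑ i : Fin k → Fin (Module.finrank ℝ V), α (fun a => b (i a)) *
          (Equiv.Perm.sign σ • ∏ a, β (i a) ((v ∘ σ) a))) = α v := by
      intro σ _
      have h1 : α (v ∘ σ) = Equiv.Perm.sign σ • α v := α.toAlternatingMap.map_perm v σ
      rw [hv] at h1
      have h2 : α v = Equiv.Perm.sign σ • Equiv.Perm.sign σ • α v := by
        rw [smul_smul, Int.units_mul_self, one_smul]
      rw [h2, ← h1, Finset.smul_sum]
      refine Finset.sum_congr rfl fun i _ => ?_
      rw [mul_smul_comm]
    rw [Finset.sum_congr rfl hσ, Finset.sum_const, Finset.card_univ, Fintype.card_perm,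
      Fintype.card_fin, nsmul_eq_mul]
  rw [hα]
  exact Submodule.smul_mem _ _ (Submodule.sum_mem _ fun i _ =>
    Submodule.smul_mem _ _ (covectorWedge_mem_iSup hJ _))

theorem typeProj_mem [T2Space V] [FiniteDimensional ℝ V] {J : V →L[ℝ] V}
    (hJ : ∀ v, J (J v) = -v) (p q : ℕ) {k : ℕ} (α : V [⋀^Fin k]→L[ℝ] ℂ) :
    typeProj J p q α ∈ typeForms J p q k := by
  by_cases hk : p + q = k
  swap
  · rw [typeProj, if_neg hk]; exact Submodule.zero_mem _
  have hα : α ∈ ⨆ pq ∈ Finset.HasAntidiagonal.antidiagonal k, typeForms J pq.1 pq.2 k := by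
    rw [iSup_typeForms hJ]; trivial
  rw [iSup_subtype'] at hα
  induction hα using Submodule.iSup_induction' with
  | mem i x hx =>
    by_cases h : (p, q) = i.1
    · rw [← h] at hx
      rwa [typeProj_of_mem hk hx]
    · rw [typeProj_of_mem_of_ne (p' := i.1.1) (q' := i.1.2) h hx]
      exact Submodule.zero_mem _
  | zero =>
    rw [typeProj_zero]
    exact Submodule.zero_mem _
  | add x y _ _ hx hy => rw [typeProj_add]; exact Submodule.add_mem _ hx hy

theorem sum_typeProj [T2Space V] [FiniteDimensional ℝ V] {J : V →L[ℝ] V}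
    (hJ : ∀ v, J (J v) = -v) {k : ℕ} (α : V [⋀^Fin k]→L[ℝ] ℂ) :
    ∑ pq ∈ Finset.HasAntidiagonal.antidiagonal k, typeProj J pq.1 pq.2 α = α := by
  have hα : α ∈ ⨆ pq ∈ Finset.HasAntidiagonal.antidiagonal k, typeForms J pq.1 pq.2 k := by
    rw [iSup_typeForms hJ]; trivial
  rw [iSup_subtype'] at hα
  induction hα using Submodule.iSup_induction' with
  | mem i x hx =>
    rw [Finset.sum_eq_single_of_mem i.1 i.2, typeProj_of_mem (Finset.HasAntidiagonal.mem_antidiagonal.1 i.2) hx]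
    intro j _ hj
    exact typeProj_of_mem_of_ne hj hx
  | zero =>
    refine Finset.sum_eq_zero fun pq _ => ?_
    exact typeProj_zero J pq.1 pq.2 k
  | add x y _ _ hx hy => simp only [typeProj_add, Finset.sum_add_distrib, hx, hy]

end Types

end Pointwise

/-! ### Almost Hermitian manifolds -/

/-- The model space of a manifold of real dimension `2n`. -/
abbrev Model (n : ℕ) : Type := EuclideanSpace ℝ (Fin (2 * n))

end AlmostHermitian

open AlmostHermitian in
/-- An almost Hermitian structure `(J, g)` on a smooth manifold `X` of real dimension `2n`: a smooth
almost complex structure `J` and a smooth Riemannian metric `g` with `g (J u, J v) = g (u, v)`. -/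
structure AlmostHermitianStructure (n : ℕ) (X : Type*) [TopologicalSpace X]
    [ChartedSpace (Model n) X] [IsManifold (𝓡 (2 * n)) ∞ X] where
  J (x : X) : TangentSpace (𝓡 (2 * n)) x →L[ℝ] TangentSpace (𝓡 (2 * n)) x
  contMDiff_J : ContMDiff (𝓡 (2 * n)) ((𝓡 (2 * n)).prod 𝓘(ℝ, Model n →L[ℝ] Model n)) ∞
    (fun x => TotalSpace.mk' (Model n →L[ℝ] Model n)
      (E := fun x : X => TangentSpace (𝓡 (2 * n)) x →L[ℝ] TangentSpace (𝓡 (2 * n)) x) x (J x))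
  J_J (x : X) (v : TangentSpace (𝓡 (2 * n)) x) : J x (J x v) = -v
  g : ContMDiffRiemannianMetric (𝓡 (2 * n)) ∞ (Model n)
    (fun x : X => TangentSpace (𝓡 (2 * n)) x)
  g_J (x : X) (u v : TangentSpace (𝓡 (2 * n)) x) :
    g.inner x (J x u) (J x v) = g.inner x u v

namespace AlmostHermitian

section Forms

variable (n : ℕ) (X : Type*) [TopologicalSpace X] [ChartedSpace (Model n) X]

/-- Complex differential forms of degree `k`, as families of alternating forms on the tangent spaces
(smoothness is imposed separately, see `IsSmooth`). -/
abbrev Form (k : ℕ) : Type _ :=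
  (x : X) → TangentSpace (𝓡 (2 * n)) x [⋀^Fin k]→L[ℝ] ℂ

/-- Complex differential forms of mixed degree: `α k` is the component of degree `k`. -/
abbrev MixedForm : Type _ := (k : ℕ) → Form n X k

variable {n X}

/-- A `k`-form is smooth if it is a smooth section of the bundle of alternating forms. -/
def Form.IsSmooth [IsManifold (𝓡 (2 * n)) ∞ X] {k : ℕ} (α : Form n X k) : Prop :=
  ContMDiff (𝓡 (2 * n)) ((𝓡 (2 * n)).prod 𝓘(ℝ, Model n [⋀^Fin k]→L[ℝ] ℂ)) ∞
    (fun x => TotalSpace.mk' (Model n [⋀^Fin k]→L[ℝ] ℂ)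
      (E := fun x : X => TangentSpace (𝓡 (2 * n)) x [⋀^Fin k]→L[ℝ] Bundle.Trivial X ℂ x) x (α x))

/-- The expression of a `k`-form in the preferred chart `φ` at `x₀`: the pullback `(φ⁻¹)^* α`. -/
def Form.inChart {k : ℕ} (α : Form n X k) (x₀ : X) (y : Model n) : Model n [⋀^Fin k]→L[ℝ] ℂ :=
  (α ((extChartAt (𝓡 (2 * n)) x₀).symm y)).compContinuousLinearMap
    (mfderiv 𝓘(ℝ, Model n) (𝓡 (2 * n)) (extChartAt (𝓡 (2 * n)) x₀).symm y)

/-- The exterior derivative: `(dα)_x = φ^* (d ((φ⁻¹)^* α))` at `x`, with `φ` the chart at `x`. -/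
def Form.d {k : ℕ} (α : Form n X k) : Form n X (k + 1) := fun x =>
  (extDeriv (α.inChart x) (extChartAt (𝓡 (2 * n)) x x)).compContinuousLinearMap
    (mfderiv (𝓡 (2 * n)) 𝓘(ℝ, Model n) (extChartAt (𝓡 (2 * n)) x) x)

theorem continuous_bilin (x : X)
    (B : TangentSpace (𝓡 (2 * n)) x →L[ℝ] TangentSpace (𝓡 (2 * n)) x →L[ℝ] ℝ) :
    Continuous fun w : TangentSpace (𝓡 (2 * n)) x × TangentSpace (𝓡 (2 * n)) x =>
      B w.1 w.2 := by
  let B' : Model n →L[ℝ] Model n →L[ℝ] ℝ := B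
  exact (show Continuous fun w : Model n × Model n => B' w.1 w.2 by fun_prop)

end Forms

end AlmostHermitian

namespace AlmostHermitianStructure

open AlmostHermitian

variable {n : ℕ} {X : Type*} [TopologicalSpace X] [ChartedSpace (Model n) X]
  [IsManifold (𝓡 (2 * n)) ∞ X] (A : AlmostHermitianStructure n X)

theorem exists_frame (x : X) :
    ∃ e : Fin (2 * n) → TangentSpace (𝓡 (2 * n)) x, IsUnitaryFrame (A.J x) (A.g.inner x) e :=
  exists_isUnitaryFrame
    (show Module.finrank ℝ (EuclideanSpace ℝ (Fin (2 * n))) = 2 * n by simp)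
    (A.J_J x) (A.g.symm x) (A.g.pos x) (A.g_J x)

/-- A unitary frame of the tangent space at `x` (the Hodge star does not depend on it). -/
def frame (x : X) : Fin (2 * n) → TangentSpace (𝓡 (2 * n)) x := (A.exists_frame x).choose

/-- The complex-linear Hodge star of `g` and of the orientation given by `J`. -/
def star (α : MixedForm n X) : MixedForm n X := fun m x =>
  if h : m ≤ 2 * n then
    frameStar (Nat.sub_add_cancel h) (A.g.inner x) (A.frame x) (α (2 * n - m) x)
  else 0

theorem g_J_self (x : X) (v : TangentSpace (𝓡 (2 * n)) x) :
    ((A.g.inner x).comp (A.J x)) v v = 0 := by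
  have h := A.g_J x (A.J x v) v
  rw [A.J_J, map_neg, A.g.symm x (A.J x v) v] at h
  have h2 := A.g.symm x v (A.J x v)
  simp only [ContinuousLinearMap.comp_apply]
  simp only [neg_apply] at h
  linarith

/-- The fundamental form `ω (u, v) = g (J u, v)`. -/
def fundamentalForm : Form n X 2 := fun x =>
  twoForm ((A.g.inner x).comp (A.J x)) (continuous_bilin x _) (A.g_J_self x)

/-- The Lefschetz operator `L α = ω ∧ α`. -/
def L (α : MixedForm n X) : MixedForm n X
  | 0 => 0
  | 1 => 0
  | k + 2 => fun x => wedge (Nat.add_comm 2 k) (A.fundamentalForm x) (α k x)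

/-- The dual Lefschetz operator `Λ = -*L*`. -/
def dualL (α : MixedForm n X) : MixedForm n X := -A.star (A.L (A.star α))

/-- The operator `∂`: on forms of bidegree `(p, q)` it is the `(p+1, q)`-component of `d`. -/
def del (α : MixedForm n X) : MixedForm n X
  | 0 => 0
  | k + 1 => ∑ pq ∈ Finset.HasAntidiagonal.antidiagonal k, fun x =>
      typeProj (A.J x) (pq.1 + 1) pq.2
        (Form.d (fun y => typeProj (A.J y) pq.1 pq.2 (α k y)) x)

/-- The operator `∂̄`: on forms of bidegree `(p, q)` it is the `(p, q+1)`-component of `d`. -/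
def delbar (α : MixedForm n X) : MixedForm n X
  | 0 => 0
  | k + 1 => ∑ pq ∈ Finset.HasAntidiagonal.antidiagonal k, fun x =>
      typeProj (A.J x) pq.1 (pq.2 + 1)
        (Form.d (fun y => typeProj (A.J y) pq.1 pq.2 (α k y)) x)

/-- The adjoint `∂^* = -* ∂̄ *`. -/
def delAdj (α : MixedForm n X) : MixedForm n X := -A.star (A.delbar (A.star α))

/-- The adjoint `∂̄^* = -* ∂ *`. -/
def delbarAdj (α : MixedForm n X) : MixedForm n X := -A.star (A.del (A.star α))

/-- The Laplacian `∂ ∂^* + ∂^* ∂`. -/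
def laplacianDel (α : MixedForm n X) : MixedForm n X := A.del (A.delAdj α) + A.delAdj (A.del α)

/-- The Laplacian `∂̄ ∂̄^* + ∂̄^* ∂̄`. -/
def laplacianDelbar (α : MixedForm n X) : MixedForm n X :=
  A.delbar (A.delbarAdj α) + A.delbarAdj (A.delbar α)

/-- The space `A^{p,q}(X)` of smooth forms of bidegree `(p, q)`. -/
def bidegreeForms (p q : ℕ) : Set (MixedForm n X) :=
  {α | (∀ k, (α k).IsSmooth) ∧ (∀ x, α (p + q) x ∈ typeForms (A.J x) p q (p + q)) ∧
    ∀ k, k ≠ p + q → α k = 0}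

/-- The space of `∂`-harmonic forms of bidegree `(p, q)`. -/
def harmonicDel (p q : ℕ) : Set (MixedForm n X) :=
  {α | α ∈ A.bidegreeForms p q ∧ A.laplacianDel α = 0}

/-- The space of `∂̄`-harmonic forms of bidegree `(p, q)`. -/
def harmonicDelbar (p q : ℕ) : Set (MixedForm n X) :=
  {α | α ∈ A.bidegreeForms p q ∧ A.laplacianDelbar α = 0}

/-- The primitive forms of bidegree `(p, q)`: those with `Λ α = 0`. -/
def primitiveForms (p q : ℕ) : Set (MixedForm n X) :=
  {α | α ∈ A.bidegreeForms p q ∧ A.dualL α = 0}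

end AlmostHermitianStructure

end

/-! The Hodge star alone produces the four identities. Write `α` for a form of bidegree `(k, 0)` or
`(0, k)` with `k ≤ n`. Pointwise `*α = c L^{n-k} α` with a nonzero constant `c` depending only on
`n` and the bidegree (`hodge_single_of_mem`, `star_of_isOfType`). On the other hand, `** = (-1)^deg`
together with `∂^* = -*∂̄*` and `∂̄^* = -*∂*` formally gives `Δ_∂̄ * = * Δ_∂` and the same with `∂`,
`∂̄` exchanged (`laplacian_star`). So `α` is harmonic for one operator exactly when `L^{n-k} α` is
harmonic for the other. No Kähler identity, integrability or integration by parts enters.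

The formula for `*α` is proved by induction on the number of covectors in a product of covectors of
one type, `θ ∘ J = s θ` with `s = ±i`. It starts from `*1 = ω^n / n!`. Multiplication by `θ`
becomes, after the star, contraction with the dual vector of `θ`. This contraction kills products of
covectors of the same type, because such covectors are mutually isotropic for the complex bilinear
extension of `g`; its commutator with `L^{m+1}` is `-(m+1) s L^m (θ ∧ ·)`. Hence each covector
lowers the power of `L` by one.

Bidegrees are read off from the circle action `e^{tJ}`: the degree `p + q` and the weight `p - q`
determine `(p, q)`, and `*` and `L` commute with the action. This shows that the star carries `(a,
b)` to `(n-b, n-a)`, and that primitivity is automatic: for `α` as above, `L * α` would have a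
holomorphic or antiholomorphic degree `n + 1`.

Surjectivity also needs smoothness of the preimage, a multiple of `*β`. The frames defining the star
are chosen pointwise, without continuity, so smoothness is recovered from `L^{n-k} α = β`: in a
trivialization this is a linear system with smooth coefficients which is injective on forms of the
given bidegree (`isSmooth_of_isSmooth_L_iterate`). -/

noncomputable section

namespace AlmostHermitian

/-! ### Exterior multiplication and contraction on mixed forms. -/

section Operators

variable {V : Type*} [NormedAddCommGroup V] [NormedSpace ℝ V]

variable (V) in
/-- Complex-valued alternating forms of mixed degree on a vector space. -/
abbrev MixedAlt : Type _ := ∀ k : ℕ, V [⋀^Fin k]→L[ℝ] ℂ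

/-- Left exterior multiplication of a `k`-form by a covector. -/
def extMul {k : ℕ} (θ : V →L[ℝ] ℂ) (β : V [⋀^Fin k]→L[ℝ] ℂ) : V [⋀^Fin (k + 1)]→L[ℝ] ℂ :=
  ContinuousAlternatingMap.alternatizeUncurryFin (θ.smulRight β)

theorem extMul_apply {k : ℕ} (θ : V →L[ℝ] ℂ) (β : V [⋀^Fin k]→L[ℝ] ℂ) (v : Fin (k + 1) → V) :
    extMul θ β v = ∑ i : Fin (k + 1), (-1) ^ (i : ℕ) * (θ (v i) * β (i.removeNth v)) := by
  simp [extMul, ContinuousAlternatingMap.alternatizeUncurryFin_apply]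

/-- Contraction with a vector. -/
def contract (u : V) : MixedAlt V →ₗ[ℂ] MixedAlt V where
  toFun α k := (α (k + 1)).curryLeft u
  map_add' _ _ := rfl
  map_smul' _ _ := rfl

/-- Exterior multiplication by a covector. -/
def covMul (θ : V →L[ℝ] ℂ) : MixedAlt V →ₗ[ℂ] MixedAlt V where
  toFun α
    | 0 => 0
    | k + 1 => extMul θ (α k)
  map_add' α β := by
    funext k
    cases k with
    | zero => exact (add_zero 0).symm
    | succ k => ext v; simp [extMul_apply, mul_add, Finset.sum_add_distrib]
  map_smul' c α := by
    funext k
    cases k with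
    | zero => ext v; simp
    | succ k => 
      ext v
      simp only [extMul_apply, Pi.smul_apply, RingHom.id_apply, Finset.mul_sum,
        ContinuousAlternatingMap.smul_apply, smul_eq_mul]
      exact Finset.sum_congr rfl fun _ _ => by ring

theorem contract_apply (u : V) (α : MixedAlt V) (k : ℕ) (v : Fin k → V) :
    contract u α k v = α (k + 1) (Fin.cons u v) := rfl

@[simp] theorem covMul_zero_deg (θ : V →L[ℝ] ℂ) (α : MixedAlt V) : covMul θ α 0 = 0 := rfl
@[simp] theorem covMul_succ (θ : V →L[ℝ] ℂ) (α : MixedAlt V) (k : ℕ) :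
    covMul θ α (k + 1) = extMul θ (α k) := rfl

/-- In the expansion of `θ ∧ α` the term of index `0` puts `u` into `θ`; all others put `u` into
`α`, with the index and hence the sign shifted by one. The commutators below are computed from this
relation. -/
theorem contract_covMul (u : V) (θ : V →L[ℝ] ℂ) (α : MixedAlt V) :
    contract u (covMul θ α) = θ u • α - covMul θ (contract u α) := by
  funext k
  ext v
  cases k with
  | zero =>
    rw [contract_apply, covMul_succ, extMul_apply]
    simp
  | succ k =>
    rw [contract_apply, covMul_succ, extMul_apply, Fin.sum_univ_succ]
    simp only [Pi.sub_apply, Pi.smul_apply, ContinuousAlternatingMap.sub_apply,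
      ContinuousAlternatingMap.smul_apply, covMul_succ, extMul_apply, smul_eq_mul, contract_apply]
    rw [sub_eq_add_neg, ← Finset.sum_neg_distrib]
    congr 1
    · simp
    · refine Finset.sum_congr rfl fun i _ => ?_
      have : (i.succ.removeNth (Fin.cons u v : Fin (k + 2) → V)) =
          Fin.cons u (i.removeNth v) := by
        funext j
        cases j using Fin.cases <;> simp [Fin.removeNth]
      rw [this]
      simp [pow_succ]

theorem covMul_add_left (θ η : V →L[ℝ] ℂ) : covMul (θ + η) = covMul θ + covMul η := by
  refine LinearMap.ext fun α => funext fun k => ?_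
  cases k with
  | zero => exact (add_zero 0).symm
  | succ k => ext v; simp [extMul_apply, add_mul, mul_add, Finset.sum_add_distrib]

theorem covMul_smul_left (c : ℂ) (θ : V →L[ℝ] ℂ) : covMul (c • θ) = c • covMul θ := by
  refine LinearMap.ext fun α => funext fun k => ?_
  cases k with
  | zero => simp [covMul_zero_deg]
  | succ k =>
    ext v
    simp only [extMul_apply, Finset.mul_sum, LinearMap.smul_apply, Pi.smul_apply, covMul_succ,
      ContinuousAlternatingMap.smul_apply, smul_eq_mul, smul_apply]
    exact Finset.sum_congr rfl fun _ _ => by ring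

/-- Exterior multiplication as a linear map in the covector. -/
def covMulHom : (V →L[ℝ] ℂ) →ₗ[ℂ] (MixedAlt V →ₗ[ℂ] MixedAlt V) where
  toFun := covMul
  map_add' := covMul_add_left
  map_smul' := covMul_smul_left

theorem covMul_sum_smul {ι : Type*} (s : Finset ι) (c : ι → ℂ) (θ : ι → V →L[ℝ] ℂ) :
    covMul (∑ i ∈ s, c i • θ i) = ∑ i ∈ s, c i • covMul (θ i) := by
  change covMulHom _ = _
  rw [map_sum]
  exact Finset.sum_congr rfl fun _ _ => map_smul _ _ _

/-- A form of positive degree is determined by its contractions, so induction on the degree applies.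
This turns identities between operators into a check that they commute with contraction. -/
theorem mixed_eq_zero_of_contract (T : MixedAlt V → MixedAlt V) (h0 : ∀ α, T α 0 = 0)
    (hT : ∀ u α, contract u (T α) = T (contract u α)) (α : MixedAlt V) : T α = 0 := by
  funext k
  induction k generalizing α with
  | zero => exact h0 α
  | succ k ih =>
    ext v
    have h1 := congrArg (fun f => f (Fin.tail v)) (congrFun (hT (v 0) α) k)
    rw [ih] at h1
    simp only [contract_apply, Fin.cons_self_tail] at h1
    exact h1

/-- The anticommutator of two exterior multiplications commutes with every contraction, since the
scalar terms of `contract_covMul` cancel. -/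
theorem covMul_anticomm (θ η : V →L[ℝ] ℂ) (α : MixedAlt V) :
    covMul θ (covMul η α) = - covMul η (covMul θ α) := by
  rw [eq_neg_iff_add_eq_zero]
  refine mixed_eq_zero_of_contract (fun α => covMul θ (covMul η α) + covMul η (covMul θ α))
    (fun α => add_zero 0) (fun u α => ?_) α
  simp only [map_add, contract_covMul, map_sub, map_smul]
  abel

/-- The sign operator `(-1)^deg`. -/
def degSign : MixedAlt V →ₗ[ℂ] MixedAlt V where
  toFun α k := (-1 : ℂ) ^ k • α k
  map_add' _ _ := funext fun _ => smul_add _ _ _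
  map_smul' c α := funext fun k => smul_comm ((-1 : ℂ) ^ k) c (α k)

theorem degSign_apply (α : MixedAlt V) (k : ℕ) : degSign α k = (-1 : ℂ) ^ k • α k := rfl

/-- Pullback of mixed forms. -/
def pull (R : V →L[ℝ] V) : MixedAlt V →ₗ[ℂ] MixedAlt V where
  toFun α k := (α k).compContinuousLinearMap R
  map_add' _ _ := rfl
  map_smul' _ _ := rfl

theorem pull_apply (R : V →L[ℝ] V) (α : MixedAlt V) (k : ℕ) (v : Fin k → V) :
    pull R α k v = α k (fun i => R (v i)) := rfl

theorem pull_covMul (R : V →L[ℝ] V) (θ : V →L[ℝ] ℂ) (α : MixedAlt V) :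
    pull R (covMul θ α) = covMul (θ.comp R) (pull R α) := by
  funext k
  cases k with
  | zero => rfl
  | succ k => ext v; simp [pull_apply, extMul_apply]; rfl

theorem contract_pull (R : V →L[ℝ] V) (u : V) (α : MixedAlt V) :
    contract u (pull R α) = pull R (contract (R u) α) := by
  funext k
  ext v
  rw [contract_apply, pull_apply, pull_apply, contract_apply]
  congr 1
  funext i
  cases i using Fin.cases <;> simp

/-- The constant function `1` as a mixed form. -/
def one : MixedAlt V := Pi.single 0 (ContinuousAlternatingMap.constOfIsEmpty ℝ V (Fin 0) 1)

theorem single_covectorWedge_zero (θ : Fin 0 → V →L[ℝ] ℂ) :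
    (Pi.single 0 (covectorWedge θ) : MixedAlt V) = one := by
  unfold one
  congr 1
  ext v
  simp [covectorWedge_apply]

theorem covMul_single {k : ℕ} (θ : V →L[ℝ] ℂ) (β : V [⋀^Fin k]→L[ℝ] ℂ) :
    covMul θ (Pi.single k β) = (Pi.single (k + 1) (extMul θ β) : MixedAlt V) := by
  funext j
  cases j with
  | zero => rw [Pi.single_eq_of_ne (by omega)]; rfl
  | succ j =>
    rw [covMul_succ]
    by_cases h : j = k
    · subst h; simp
    · rw [Pi.single_eq_of_ne h, Pi.single_eq_of_ne (by omega)]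
      ext v; simp [extMul_apply]

theorem covectorWedge_succ {k : ℕ} (θ : Fin (k + 1) → V →L[ℝ] ℂ) :
    covectorWedge θ = extMul (θ 0) (covectorWedge (Fin.tail θ)) := by
  ext v
  rw [covectorWedge_apply, Matrix.det_succ_row_zero, extMul_apply]
  refine Finset.sum_congr rfl fun i _ => ?_
  rw [covectorWedge_apply, mul_assoc]
  rfl

theorem single_covectorWedge_succ {k : ℕ} (θ : Fin (k + 1) → V →L[ℝ] ℂ) :
    (Pi.single (k + 1) (covectorWedge θ) : MixedAlt V) =
      covMul (θ 0) (Pi.single k (covectorWedge (Fin.tail θ))) := by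
  rw [covMul_single, covectorWedge_succ]

theorem degSign_single {k : ℕ} (β : V [⋀^Fin k]→L[ℝ] ℂ) :
    degSign (Pi.single k β) = ((-1 : ℂ) ^ k • Pi.single k β : MixedAlt V) := by
  funext j
  rw [degSign_apply, Pi.smul_apply]
  by_cases h : j = k
  · subst h; rfl
  · rw [Pi.single_eq_of_ne h]; ext v; simp

theorem degSign_covMul (θ : V →L[ℝ] ℂ) (α : MixedAlt V) :
    degSign (covMul θ α) = - covMul θ (degSign α) := by
  funext k
  cases k with
  | zero => simp [degSign_apply]
  | succ k =>
    ext v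
    simp only [degSign_apply, covMul_succ, Pi.neg_apply, ContinuousAlternatingMap.smul_apply,
      ContinuousAlternatingMap.neg_apply, extMul_apply, smul_eq_mul, Finset.mul_sum, pow_succ,
      ← Finset.sum_neg_distrib]
    exact Finset.sum_congr rfl fun _ _ => by ring

theorem degSign_contract (u : V) (α : MixedAlt V) :
    degSign (contract u α) = - contract u (degSign α) := by
  funext k
  ext v
  simp [degSign_apply, contract_apply, pow_succ]

theorem degSign_pull (R : V →L[ℝ] V) (α : MixedAlt V) :
    degSign (pull R α) = pull R (degSign α) := rfl

theorem degSign_degSign (α : MixedAlt V) : degSign (degSign α) = α := by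
  funext k
  rw [degSign_apply, degSign_apply, smul_smul, ← mul_pow]
  simp

theorem pull_one (R : V →L[ℝ] V) : pull R one = (one : MixedAlt V) := by
  funext k
  ext v
  cases k with
  | zero => simp [one, pull_apply]
  | succ k => rw [pull_apply]; simp [one]

theorem contract_one (u : V) : contract u one = (0 : MixedAlt V) := by
  funext k
  ext v
  rw [contract_apply]; simp [one]

end Operators

/-! ### The normalized wedge product. -/

section Wedge

variable {V : Type*} [NormedAddCommGroup V] [NormedSpace ℝ V]

theorem sum_sign_comp_perm {W : Type*} {m : ℕ} (F : (Fin m → W) → ℂ) (v : Fin m → W)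
    (τ : Equiv.Perm (Fin m)) :
    ∑ σ : Equiv.Perm (Fin m), ((Equiv.Perm.sign σ : ℤ) : ℂ) * F ((v ∘ σ) ∘ τ) =
      ((Equiv.Perm.sign τ : ℤ) : ℂ) *
        ∑ σ : Equiv.Perm (Fin m), ((Equiv.Perm.sign σ : ℤ) : ℂ) * F (v ∘ σ) := by
  rw [← Equiv.sum_comp (Equiv.mulRight τ)
    (fun σ => ((Equiv.Perm.sign σ : ℤ) : ℂ) * F (v ∘ σ)), Finset.mul_sum]
  refine Finset.sum_congr rfl fun σ _ => ?_
  rcases Int.units_eq_one_or (Equiv.Perm.sign τ) with h | h <;>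
    simp [h, Function.comp_assoc]

theorem wedge_apply {k l m : ℕ} (h : k + l = m) (a : V [⋀^Fin k]→L[ℝ] ℂ)
    (b : V [⋀^Fin l]→L[ℝ] ℂ) (v : Fin m → V) :
    wedge h a b v = ((k.factorial * l.factorial : ℂ)⁻¹) *
      ∑ σ : Equiv.Perm (Fin m), ((Equiv.Perm.sign σ : ℤ) : ℂ) * tensorMul h a b (v ∘ σ) := by
  rw [wedge, ContinuousAlternatingMap.smul_apply,
    ContinuousMultilinearMap.alternatization_apply_apply, smul_eq_mul]
  congr 1
  refine Finset.sum_congr rfl fun σ _ => ?_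
  rw [Units.smul_def, zsmul_eq_mul]

theorem tensorMul_apply {k l m : ℕ} (h : k + l = m) (a : V [⋀^Fin k]→L[ℝ] ℂ)
    (b : V [⋀^Fin l]→L[ℝ] ℂ) (v : Fin m → V) :
    tensorMul h a b v = a (fun i => v (Fin.cast h (Fin.castAdd l i))) *
      b (fun j => v (Fin.cast h (Fin.natAdd k j))) := rfl

/-- Both sides are multiples of one alternating sum, that of `θ ⊗ β ⊗ γ`. This associativity rule
lets a covector cross a wedge, which is all that is needed for the star and for `L`. -/
theorem wedge_extMul {k l m : ℕ} (h1 : (k + 1) + l = m) (h2 : k + (l + 1) = m)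
    (θ : V →L[ℝ] ℂ) (β : V [⋀^Fin k]→L[ℝ] ℂ) (γ : V [⋀^Fin l]→L[ℝ] ℂ) :
    wedge h1 (extMul θ β) γ = (-1 : ℂ) ^ k • wedge h2 β (extMul θ γ) := by
  obtain ⟨M, rfl⟩ : ∃ M, m = M + 1 := ⟨k + l, by omega⟩
  ext v
  let F : (Fin (M + 1) → V) → ℂ := fun w => θ (w 0) *
    (β (fun i : Fin k => w ⟨i + 1, by omega⟩) * γ (fun j : Fin l => w ⟨k + 1 + j, by omega⟩))
  set S := ∑ σ : Equiv.Perm (Fin (M + 1)), ((Equiv.Perm.sign σ : ℤ) : ℂ) * F (v ∘ σ) with hS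
  -- The `i`-th term of the expansion has the `i`-th vector moved to the front; this is the cycle
  -- `Fin.cycleRange`, of sign `(-1)^i`.
  have e1 : ∀ w, tensorMul h1 (extMul θ β) γ w = ∑ i : Fin (k + 1), (-1 : ℂ) ^ (i : ℕ) *
      F (w ∘ (Fin.cycleRange (⟨i, by omega⟩ : Fin (M + 1))).symm) := by
    intro w
    rw [tensorMul_apply, extMul_apply, Finset.sum_mul]
    refine Finset.sum_congr rfl fun i _ => ?_
    simp only [F, Function.comp_apply, Fin.cycleRange_symm_zero, mul_assoc]
    congr 4
    · funext j
      rw [show (⟨(j : ℕ) + 1, by omega⟩ : Fin (M + 1)) =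
        Fin.succ ⟨j, by omega⟩ from rfl, Fin.cycleRange_symm_succ]
      simp only [Fin.removeNth]
      congr 1
      simp only [Fin.succAbove, Fin.lt_def, Fin.ext_iff]
      split_ifs with h h' h' <;> simp_all <;> omega
    · funext j
      rw [show (⟨k + 1 + (j : ℕ), by omega⟩ : Fin (M + 1)) =
        Fin.succ ⟨k + j, by omega⟩ from Fin.ext (by simp; omega), Fin.cycleRange_symm_succ]
      congr 1
      simp only [Fin.succAbove, Fin.lt_def, Fin.ext_iff]
      split_ifs with h <;> simp_all <;> omega
  -- Here the vector brought to the front sits at position `k + i`, behind the arguments of `β`;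
  -- this is the source of the sign `(-1)^k`.
  have e2 : ∀ w, tensorMul h2 β (extMul θ γ) w = ∑ i : Fin (l + 1), (-1 : ℂ) ^ (i : ℕ) *
      F (w ∘ (Fin.cycleRange (⟨k + i, by omega⟩ : Fin (M + 1))).symm) := by
    intro w
    rw [tensorMul_apply, extMul_apply, Finset.mul_sum]
    refine Finset.sum_congr rfl fun i _ => ?_
    simp only [F, Function.comp_apply, Fin.cycleRange_symm_zero]
    rw [mul_left_comm (β _), mul_left_comm (β _)]
    congr 4
    · funext j
      rw [show (⟨(j : ℕ) + 1, by omega⟩ : Fin (M + 1)) =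
        Fin.succ ⟨j, by omega⟩ from rfl, Fin.cycleRange_symm_succ]
      congr 1
      simp only [Fin.succAbove, Fin.lt_def, Fin.ext_iff]
      split_ifs with h <;> simp_all <;> omega
    · funext j
      rw [show (⟨k + 1 + (j : ℕ), by omega⟩ : Fin (M + 1)) =
        Fin.succ ⟨k + j, by omega⟩ from Fin.ext (by simp; omega), Fin.cycleRange_symm_succ]
      simp only [Fin.removeNth]
      congr 1
      simp only [Fin.succAbove, Fin.lt_def, Fin.ext_iff]
      split_ifs with h h' h' <;> simp_all <;> omega
  have key : ∀ (N : ℕ) (f : Fin N → ℕ) (hf : ∀ i, f i < M + 1) ,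
      ∑ σ : Equiv.Perm (Fin (M + 1)), ((Equiv.Perm.sign σ : ℤ) : ℂ) *
        ∑ i : Fin N, (-1 : ℂ) ^ (i : ℕ) *
          F ((v ∘ σ) ∘ (Fin.cycleRange (⟨f i, hf i⟩ : Fin (M + 1))).symm) =
      (∑ i : Fin N, (-1 : ℂ) ^ (i : ℕ) * (-1) ^ (f i)) * S := by
    intro N f hf
    simp only [Finset.mul_sum]
    rw [Finset.sum_comm, Finset.sum_mul]
    refine Finset.sum_congr rfl fun i _ => ?_
    simp only [mul_left_comm _ ((-1 : ℂ) ^ (i : ℕ))]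
    rw [← Finset.mul_sum, sum_sign_comp_perm, Equiv.Perm.sign_symm, Fin.sign_cycleRange]
    simp [mul_assoc, hS]
  rw [ContinuousAlternatingMap.smul_apply, wedge_apply, wedge_apply]
  simp only [e1, e2]
  rw [key (k + 1) (fun i => i) (fun i => by omega),
    key (l + 1) (fun i => k + i) (fun i => by omega)]
  -- All terms contribute equally: `k + 1` copies of `S` on the left and `l + 1` copies of `(-1)^k
  -- S` on the right. The factorials in `wedge` absorb these counts.
  have s1 : ∀ i : ℕ, (-1 : ℂ) ^ i * (-1) ^ i = 1 := fun i => by rw [← mul_pow]; simp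
  have s2 : ∀ i : ℕ, (-1 : ℂ) ^ i * (-1) ^ (k + i) = (-1) ^ k := fun i => by
    rw [pow_add, mul_left_comm, s1, mul_one]
  simp only [s1, s2, Finset.sum_const, Finset.card_univ, Fintype.card_fin, nsmul_eq_mul, mul_one,
    Nat.factorial_succ, smul_eq_mul]
  have := s1 k
  have hk : (k.factorial : ℂ) ≠ 0 := by exact_mod_cast k.factorial_ne_zero
  have hl : (l.factorial : ℂ) ≠ 0 := by exact_mod_cast l.factorial_ne_zero
  have hk' : (k + 1 : ℂ) ≠ 0 := by exact_mod_cast Nat.succ_ne_zero k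
  have hl' : (l + 1 : ℂ) ≠ 0 := by exact_mod_cast Nat.succ_ne_zero l
  push_cast
  field_simp
  linear_combination (-S) * this

theorem wedge_add_left {k l m : ℕ} (h : k + l = m) (a a' : V [⋀^Fin k]→L[ℝ] ℂ)
    (b : V [⋀^Fin l]→L[ℝ] ℂ) : wedge h (a + a') b = wedge h a b + wedge h a' b := by
  ext v
  simp [wedge_apply, tensorMul_apply, add_mul, mul_add, Finset.sum_add_distrib]

theorem wedge_add_right {k l m : ℕ} (h : k + l = m) (a : V [⋀^Fin k]→L[ℝ] ℂ)
    (b b' : V [⋀^Fin l]→L[ℝ] ℂ) : wedge h a (b + b') = wedge h a b + wedge h a b' := by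
  ext v
  simp [wedge_apply, tensorMul_apply, mul_add, Finset.sum_add_distrib]

theorem wedge_smul_left {k l m : ℕ} (h : k + l = m) (c : ℂ) (a : V [⋀^Fin k]→L[ℝ] ℂ)
    (b : V [⋀^Fin l]→L[ℝ] ℂ) : wedge h (c • a) b = c • wedge h a b := by
  ext v
  simp only [wedge_apply, tensorMul_apply, ContinuousAlternatingMap.smul_apply, smul_eq_mul,
    Finset.mul_sum]
  exact Finset.sum_congr rfl fun _ _ => by ring

theorem wedge_smul_right {k l m : ℕ} (h : k + l = m) (c : ℂ) (a : V [⋀^Fin k]→L[ℝ] ℂ)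
    (b : V [⋀^Fin l]→L[ℝ] ℂ) : wedge h a (c • b) = c • wedge h a b := by
  ext v
  simp only [wedge_apply, tensorMul_apply, ContinuousAlternatingMap.smul_apply, smul_eq_mul,
    Finset.mul_sum]
  exact Finset.sum_congr rfl fun _ _ => by ring

theorem wedge_const_left {l : ℕ} (h : 0 + l = l) (c : ℂ) (b : V [⋀^Fin l]→L[ℝ] ℂ) :
    wedge h (ContinuousAlternatingMap.constOfIsEmpty ℝ V (Fin 0) c) b = c • b := by
  ext v
  rw [wedge_apply]
  have : ∀ σ : Equiv.Perm (Fin l), ((Equiv.Perm.sign σ : ℤ) : ℂ) *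
      tensorMul h (ContinuousAlternatingMap.constOfIsEmpty ℝ V (Fin 0) c) b (v ∘ σ) =
      c * b v := by
    intro σ
    have h1 : b (v ∘ σ) = Equiv.Perm.sign σ • b v := b.toAlternatingMap.map_perm v σ
    have h2 : (fun j => (v ∘ σ) (Fin.cast h (Fin.natAdd 0 j))) = v ∘ σ := by
      funext j
      congr 1
      ext
      simp
    rw [tensorMul_apply, h2, h1]
    rcases Int.units_eq_one_or (Equiv.Perm.sign σ) with h | h <;> simp [h]
  rw [Finset.sum_congr rfl fun σ _ => this σ]
  have hl : (l.factorial : ℂ) ≠ 0 := by exact_mod_cast l.factorial_ne_zero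
  simp [Fintype.card_perm, hl]

theorem wedge_compContinuousLinearMap {k l m : ℕ} (h : k + l = m) (a : V [⋀^Fin k]→L[ℝ] ℂ)
    (b : V [⋀^Fin l]→L[ℝ] ℂ) (R : V →L[ℝ] V) :
    (wedge h a b).compContinuousLinearMap R =
      wedge h (a.compContinuousLinearMap R) (b.compContinuousLinearMap R) := by
  ext v
  simp only [ContinuousAlternatingMap.compContinuousLinearMap_apply, wedge_apply,
    tensorMul_apply]
  rfl

end Wedge

/-! ### Hodge star and Lefschetz operator in a unitary frame. -/

section Frame

variable {V : Type*} [NormedAddCommGroup V] [NormedSpace ℝ V]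

/-- The complex-valued covector `g (u, ·)`. -/
def flat (g : V →L[ℝ] V →L[ℝ] ℝ) (u : V) : V →L[ℝ] ℂ := Complex.ofRealCLM.comp (g u)

@[simp] theorem flat_apply (g : V →L[ℝ] V →L[ℝ] ℝ) (u v : V) : flat g u v = (g u v : ℂ) := rfl

/-- `(J, g)` is a Hermitian structure on a `2n`-dimensional space, `Ω` its fundamental form and `e`
a unitary frame. -/
structure IsHermitian {n : ℕ} (J : V →L[ℝ] V) (g : V →L[ℝ] V →L[ℝ] ℝ) (Ω : V [⋀^Fin 2]→L[ℝ] ℂ)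
    (e : Fin (2 * n) → V) : Prop where
  dim : Module.finrank ℝ V = 2 * n
  fin : FiniteDimensional ℝ V
  J_J : ∀ v, J (J v) = -v
  symm : ∀ u v, g u v = g v u
  g_J : ∀ u v, g (J u) (J v) = g u v
  omega_apply : ∀ v, Ω v = (g (J (v 0)) (v 1) : ℂ)
  frame : IsUnitaryFrame J g e

variable {n : ℕ} {J : V →L[ℝ] V} {g : V →L[ℝ] V →L[ℝ] ℝ} {Ω : V [⋀^Fin 2]→L[ℝ] ℂ}
  {e : Fin (2 * n) → V}

/-- The contraction with the vector that is dual to a complex covector. -/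
def sharp (e : Fin (2 * n) → V) (θ : V →L[ℝ] ℂ) : MixedAlt V →ₗ[ℂ] MixedAlt V :=
  ∑ a, θ (e a) • contract (e a)

theorem sharp_apply (θ : V →L[ℝ] ℂ) (α : MixedAlt V) :
    sharp e θ α = ∑ a, θ (e a) • contract (e a) α := by
  simp [sharp]

/-- The operator `Ω ∧ ·` on mixed forms. -/
def lefschetz (Ω : V [⋀^Fin 2]→L[ℝ] ℂ) : MixedAlt V →ₗ[ℂ] MixedAlt V where
  toFun α
    | 0 => 0
    | 1 => 0
    | k + 2 => wedge (Nat.add_comm 2 k) Ω (α k)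
  map_add' α β := by
    funext k
    match k with
    | 0 => exact (add_zero 0).symm
    | 1 => exact (add_zero 0).symm
    | k + 2 => exact wedge_add_right _ _ _ _
  map_smul' c α := by
    funext k
    match k with
    | 0 => ext v; simp
    | 1 => ext v; simp
    | k + 2 => exact wedge_smul_right _ _ _ _

theorem lefschetz_single {k : ℕ} (β : V [⋀^Fin k]→L[ℝ] ℂ) :
    lefschetz Ω (Pi.single k β) = Pi.single (k + 2) (wedge (Nat.add_comm 2 k) Ω β) := by
  funext j
  match j with
  | 0 => rw [Pi.single_eq_of_ne (by omega)]; rfl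
  | 1 => rw [Pi.single_eq_of_ne (by omega)]; rfl
  | j + 2 =>
    change wedge _ _ _ = _
    by_cases h : j = k
    · subst h; simp
    · rw [Pi.single_eq_of_ne h, Pi.single_eq_of_ne (by omega)]
      ext v
      simp [wedge_apply, tensorMul_apply]

theorem lefschetz_pow_single {k : ℕ} (m : ℕ) (β : V [⋀^Fin k]→L[ℝ] ℂ) :
    ∃ γ : V [⋀^Fin (k + 2 * m)]→L[ℝ] ℂ,
      (lefschetz Ω ^ m) (Pi.single k β) = Pi.single (k + 2 * m) γ := by
  induction m with
  | zero => exact ⟨β, rfl⟩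
  | succ m ih =>
    obtain ⟨γ, hγ⟩ := ih
    refine ⟨wedge (Nat.add_comm 2 _) Ω γ, ?_⟩
    rw [pow_succ', Module.End.mul_apply, hγ]
    exact lefschetz_single γ

/-- The Hodge star in the frame `e` on mixed forms. -/
def hodge (g : V →L[ℝ] V →L[ℝ] ℝ) (e : Fin (2 * n) → V) : MixedAlt V →ₗ[ℂ] MixedAlt V where
  toFun α m := if h : m ≤ 2 * n then frameStar (Nat.sub_add_cancel h) g e (α (2 * n - m)) else 0
  map_add' α β := by
    funext m
    ext v
    by_cases h : m ≤ 2 * n <;>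
      simp [h, frameStar, mul_add, add_mul, Finset.sum_add_distrib]
  map_smul' c α := by
    funext m
    ext v
    by_cases h : m ≤ 2 * n
    · simp only [h, dite_true, frameStar, Pi.smul_apply, ContinuousAlternatingMap.smul_apply,
        smul_eq_mul, ContinuousAlternatingMap.sum_apply, Finset.mul_sum, RingHom.id_apply]
      exact Finset.sum_congr rfl fun _ _ => by ring
    · simp [h]

theorem hodge_apply {k m : ℕ} (h : k + m = 2 * n) (α : MixedAlt V) :
    hodge g e α m = frameStar h g e (α k) := by
  obtain rfl : k = 2 * n - m := by omega
  exact dif_pos (by omega)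

theorem hodge_apply_of_lt {m : ℕ} (h : 2 * n < m) (α : MixedAlt V) : hodge g e α m = 0 :=
  dif_neg (by omega)

theorem degSign_hodge (α : MixedAlt V) : degSign (hodge g e α) = hodge g e (degSign α) := by
  funext m
  rw [degSign_apply]
  by_cases h : m ≤ 2 * n
  · obtain ⟨k, hk⟩ := Nat.exists_eq_add_of_le' h
    rw [hodge_apply hk.symm, hodge_apply hk.symm, degSign_apply]
    have : (-1 : ℂ) ^ m = (-1) ^ k := by
      have h1 : (-1 : ℂ) ^ k * (-1) ^ m = 1 := by rw [← pow_add, ← hk, pow_mul]; simp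
      have h2 : (-1 : ℂ) ^ k * (-1) ^ k = 1 := by rw [← mul_pow]; simp
      linear_combination (-1 : ℂ) ^ k * h1 - (-1) ^ m * h2
    ext v
    simp only [this, frameStar, ContinuousAlternatingMap.smul_apply, smul_eq_mul,
      ContinuousAlternatingMap.sum_apply, Finset.mul_sum]
    exact Finset.sum_congr rfl fun _ _ => by ring
  · rw [hodge_apply_of_lt (by omega), hodge_apply_of_lt (by omega)]
    ext v; simp

/-- The value of the star is a wedge product evaluated on the frame, so identities for the star
follow from identities for `wedge`. Symmetry of `g` transposes the determinant. -/
theorem frameStar_eq_wedge (hsymm : ∀ u v, g u v = g v u) {k m : ℕ} (h : k + m = 2 * n)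
    (α : V [⋀^Fin k]→L[ℝ] ℂ) (v : Fin m → V) :
    frameStar h g e α v = wedge h α (covectorWedge fun j => flat g (v j)) e := by
  rw [wedge_apply, frameStar, ContinuousAlternatingMap.smul_apply,
    ContinuousAlternatingMap.sum_apply, smul_eq_mul]
  congr 1
  refine Finset.sum_congr rfl fun σ _ => ?_
  rw [ContinuousAlternatingMap.smul_apply, covectorWedge_apply, tensorMul_apply,
    covectorWedge_apply, smul_eq_mul, ← Matrix.det_transpose, mul_assoc]
  congr 3
  ext a b
  simp [hsymm (v a)]

/-- In `frameStar_eq_wedge` the covector `g(u, ·)` moves from the first factor of the wedge to the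
second, where it acts as one more argument of the star; crossing costs the sign recorded by
`degSign`. -/
theorem hodge_covMul_flat (hsymm : ∀ u v, g u v = g v u) (u : V) (α : MixedAlt V) :
    hodge g e (covMul (flat g u) α) = contract u (hodge g e (degSign α)) := by
  funext m
  ext v
  rw [contract_apply]
  rcases lt_trichotomy m (2 * n) with h | h | h
  · obtain ⟨k, hk⟩ : ∃ k, k + (m + 1) = 2 * n := ⟨2 * n - (m + 1), by omega⟩
    rw [hodge_apply (show (k + 1) + m = 2 * n by omega), hodge_apply hk, covMul_succ,
      degSign_apply, frameStar_eq_wedge hsymm, frameStar_eq_wedge hsymm,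
      wedge_extMul _ hk, wedge_smul_left, covectorWedge_succ]
    rfl
  -- Boundary case `m = 2n`: the left side sees only degree `0` of a product with a covector, the
  -- right side only degree `2n + 1`; both vanish.
  · rw [hodge_apply_of_lt (m := m + 1) (by omega),
      hodge_apply (show 0 + m = 2 * n by omega), covMul_zero_deg]
    simp [frameStar]
  · rw [hodge_apply_of_lt (m := m + 1) (by omega), hodge_apply_of_lt h]
    rfl

theorem wedge_sum_left {k l m : ℕ} {ι : Type*} (s : Finset ι) (h : k + l = m)
    (a : ι → V [⋀^Fin k]→L[ℝ] ℂ) (b : V [⋀^Fin l]→L[ℝ] ℂ) :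
    wedge h (∑ i ∈ s, a i) b = ∑ i ∈ s, wedge h (a i) b :=
  map_sum (AddMonoidHom.mk' (fun a => wedge h a b) fun a a' => wedge_add_left h a a' b) a s

namespace IsHermitian

variable (H : IsHermitian J g Ω e)
include H

theorem sum_repr (v : V) : ∑ a, g (e a) v • e a = v := by
  have := H.fin
  have hon := H.frame.1
  have hli : LinearIndependent ℝ e := by
    rw [Fintype.linearIndependent_iff]
    intro c hc i
    have := congrArg (g (e i)) hc
    simpa [hon] using this
  have hspan := hli.span_eq_top_of_card_eq_finrank' (by simp [H.dim])
  have hv : v ∈ Submodule.span ℝ (Set.range e) := hspan ▸ Submodule.mem_top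
  obtain ⟨c, rfl⟩ := (Submodule.mem_span_range_iff_exists_fun ℝ).1 hv
  simp [hon]

theorem g_J_left (u v : V) : g (J u) v = - g u (J v) := by
  have := H.g_J u (J v)
  rw [H.J_J] at this
  simp only [map_neg] at this
  linarith

theorem sum_smul_flat (θ : V →L[ℝ] ℂ) : ∑ a, θ (e a) • flat g (e a) = θ := by
  ext v
  conv_rhs => rw [← H.sum_repr v]
  simp [mul_comm]

theorem g_eq_sum (u v : V) : g u v = ∑ a, g (e a) u * g (e a) v := by
  conv_lhs => rw [← H.sum_repr v]
  simp [H.symm u, mul_comm]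

theorem hodge_covMul (θ : V →L[ℝ] ℂ) (α : MixedAlt V) :
    hodge g e (covMul θ α) = sharp e θ (hodge g e (degSign α)) := by
  conv_lhs => rw [← H.sum_smul_flat θ, covMul_sum_smul]
  simp [sharp_apply, hodge_covMul_flat H.symm]

/-- The sum runs over the whole real frame, so each pair `e, Je` is counted twice, whence the factor
`1/2`. With it `L` becomes a sum of products of exterior multiplications. -/
theorem omega_eq : Ω = (1 / 2 : ℂ) • ∑ a, extMul (flat g (e a)) (extMul (flat g (J (e a)))
    (ContinuousAlternatingMap.constOfIsEmpty ℝ V (Fin 0) 1)) := by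
  ext v
  have h1 : ∀ u w, ∑ a, (g (e a) u : ℂ) * (g (J (e a)) w : ℂ) = (g (J u) w : ℂ) := by
    intro u w
    have h2 : ∑ a, g (e a) u * g (J (e a)) w = g (J u) w := by
      rw [H.g_J_left, H.g_eq_sum, ← Finset.sum_neg_distrib]
      exact Finset.sum_congr rfl fun a _ => by rw [H.g_J_left]; ring
    exact_mod_cast h2
  have h3 : g (J (v 1)) (v 0) = - g (J (v 0)) (v 1) := by
    rw [H.g_J_left, H.symm]
  simp [extMul_apply, Fin.sum_univ_two, H.omega_apply, Fin.removeNth, Finset.sum_add_distrib, h1,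
    h3]
  ring

theorem lefschetz_eq (α : MixedAlt V) : lefschetz Ω α =
    (1 / 2 : ℂ) • ∑ a, covMul (flat g (e a)) (covMul (flat g (J (e a))) α) := by
  funext k
  match k with
  | 0 => ext v; simp [lefschetz]
  | 1 => ext v; simp [lefschetz, extMul_apply]
  | k + 2 =>
    change wedge _ _ _ = _
    conv_lhs => rw [H.omega_eq, wedge_smul_left, wedge_sum_left]
    simp only [Pi.smul_apply, Finset.sum_apply, covMul_succ]
    congr 1
    refine Finset.sum_congr rfl fun a _ => ?_
    have h := congrFun (covMul_anticomm (flat g (e a)) (flat g (J (e a))) α) (k + 2)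
    simp only [covMul_succ, Pi.neg_apply] at h
    rw [wedge_extMul _ (show 1 + (k + 1) = k + 2 by omega),
      wedge_extMul _ (show 0 + (k + 2) = k + 2 by omega), wedge_const_left, h]
    ext v
    simp

/-- Contraction is an antiderivation, `ω` has even degree, and the contraction of `ω` with `u` is
`g(Ju, ·)`. Each of the two covectors in every term of `lefschetz_eq` gives half of the last
summand. -/
theorem contract_lefschetz (u : V) (α : MixedAlt V) : contract u (lefschetz Ω α) =
    lefschetz Ω (contract u α) + covMul (flat g (J u)) α := by
  have h1 : covMul (flat g (J u)) = ∑ a, (g (e a) u : ℂ) • covMul (flat g (J (e a))) := by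
    rw [← covMul_sum_smul]
    congr 1
    ext v
    conv_lhs => rw [← H.sum_repr u]
    simp
  have h2 : ∑ a, (g (J (e a)) u : ℂ) • covMul (flat g (e a)) =
      (-1 : ℂ) • covMul (flat g (J u)) := by
    rw [← covMul_sum_smul, ← covMul_smul_left]
    congr 1
    conv_rhs => rw [← H.sum_smul_flat (flat g (J u))]
    rw [Finset.smul_sum]
    refine Finset.sum_congr rfl fun a _ => ?_
    rw [smul_smul]
    congr 1
    simp [H.g_J_left, H.symm u]
  have h3 : covMul (flat g (J u)) α = (1 / 2 : ℂ) •
      ((∑ a, (g (e a) u : ℂ) • covMul (flat g (J (e a))) α) -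
        ∑ a, (g (J (e a)) u : ℂ) • covMul (flat g (e a)) α) := by
    have h1' := congrArg (fun f => f α) h1
    have h2' := congrArg (fun f => f α) h2
    simp only [LinearMap.sum_apply, LinearMap.smul_apply] at h1' h2'
    rw [← h1', h2']
    module
  rw [h3, H.lefschetz_eq, H.lefschetz_eq, map_smul, map_sum]
  simp only [contract_covMul, map_sub, map_smul, flat_apply, sub_sub_eq_add_sub,
    Finset.sum_sub_distrib, Finset.sum_add_distrib]
  module

theorem covMul_lefschetz (θ : V →L[ℝ] ℂ) (α : MixedAlt V) :
    covMul θ (lefschetz Ω α) = lefschetz Ω (covMul θ α) := by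
  rw [H.lefschetz_eq, H.lefschetz_eq, map_smul, map_sum]
  congr 1
  refine Finset.sum_congr rfl fun a _ => ?_
  rw [covMul_anticomm θ, covMul_anticomm θ, map_neg, neg_neg]

theorem covMul_lefschetz_pow (θ : V →L[ℝ] ℂ) (m : ℕ) (α : MixedAlt V) :
    covMul θ ((lefschetz Ω ^ m) α) = (lefschetz Ω ^ m) (covMul θ α) := by
  induction m with
  | zero => rfl
  | succ m ih =>
    rw [pow_succ', Module.End.mul_apply, Module.End.mul_apply, H.covMul_lefschetz, ih]

theorem contract_lefschetz_pow (u : V) (m : ℕ) (α : MixedAlt V) :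
    contract u ((lefschetz Ω ^ (m + 1)) α) = (lefschetz Ω ^ (m + 1)) (contract u α) +
      (m + 1 : ℂ) • (lefschetz Ω ^ m) (covMul (flat g (J u)) α) := by
  induction m with
  | zero => simp [H.contract_lefschetz]
  | succ m ih =>
    rw [pow_succ', Module.End.mul_apply, H.contract_lefschetz, ih, H.covMul_lefschetz_pow,
      map_add, map_smul, ← Module.End.mul_apply, ← pow_succ', ← Module.End.mul_apply (lefschetz Ω),
      ← pow_succ']
    push_cast
    module

/-- The dual vector of `θ` contracted into `ω` gives `∑ θ(e_a) g(J e_a, ·) = -θ ∘ J = -s θ`, so the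
commutator is again exterior multiplication by `θ` itself. This is the step that lowers the power of
`L`. -/
theorem sharp_lefschetz_pow {s : ℂ} {θ : V →L[ℝ] ℂ} (hθ : ∀ v, θ (J v) = s * θ v) (m : ℕ)
    (α : MixedAlt V) :
    sharp e θ ((lefschetz Ω ^ (m + 1)) α) = (lefschetz Ω ^ (m + 1)) (sharp e θ α) -
      ((m + 1 : ℂ) * s) • (lefschetz Ω ^ m) (covMul θ α) := by
  have h1 : ∑ a, θ (e a) • flat g (J (e a)) = (-s) • θ := by
    ext v
    have h2 := congrArg (fun f => f (J v)) (H.sum_smul_flat θ)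
    simp only [sum_apply, smul_apply, flat_apply, smul_eq_mul, hθ] at h2
    simp [H.g_J_left, h2]
  have h2 : ∑ a, θ (e a) • covMul (flat g (J (e a))) α = (-s) • covMul θ α := by
    have := congrArg (fun f => covMul f α) h1
    simp only [covMul_sum_smul, covMul_smul_left, LinearMap.sum_apply, LinearMap.smul_apply] at this
    exact this
  rw [sharp_apply, sharp_apply]
  simp only [H.contract_lefschetz_pow, smul_add, Finset.sum_add_distrib, map_sum, map_smul]
  rw [sub_eq_add_neg]
  congr 1
  have h3 := congrArg (fun f => (m + 1 : ℂ) • (lefschetz Ω ^ m) f) h2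
  simp only [map_sum, map_smul, Finset.smul_sum] at h3
  have h4 : -(((m + 1 : ℂ) * s) • (lefschetz Ω ^ m) (covMul θ α)) =
      (m + 1 : ℂ) • -s • (lefschetz Ω ^ m) (covMul θ α) := by module
  rw [h4, ← h3]
  exact Finset.sum_congr rfl fun _ _ => by module

/-- For the complex bilinear extension of `g` to covectors, `J` is skew. Two covectors with the same
eigenvalue `s` therefore satisfy `2 s ⟨θ, η⟩ = 0`. -/
theorem sum_mul_eq_zero {s : ℂ} (hs : s ≠ 0) {θ η : V →L[ℝ] ℂ} (hθ : ∀ v, θ (J v) = s * θ v)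
    (hη : ∀ v, η (J v) = s * η v) : ∑ a, θ (e a) * η (e a) = 0 := by
  have h1 : ∀ θ η : V →L[ℝ] ℂ, ∑ a, θ (J (e a)) * η (e a) = - ∑ a, θ (e a) * η (J (e a)) := by
    intro θ η
    have h2 : ∀ (θ : V →L[ℝ] ℂ) a, θ (J (e a)) = ∑ b, (g (e b) (J (e a)) : ℂ) * θ (e b) := by
      intro θ a
      conv_lhs => rw [← H.sum_repr (J (e a))]
      simp
    simp only [h2, Finset.mul_sum, Finset.sum_mul]
    rw [Finset.sum_comm, ← Finset.sum_neg_distrib]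
    refine Finset.sum_congr rfl fun a _ => ?_
    rw [← Finset.sum_neg_distrib]
    refine Finset.sum_congr rfl fun b _ => ?_
    have : g (e a) (J (e b)) = - g (e b) (J (e a)) := by
      rw [H.symm, H.g_J_left]
    rw [this]
    push_cast
    ring
  have h3 := h1 θ η
  simp only [hθ, hη, mul_assoc, mul_left_comm _ s, ← Finset.mul_sum] at h3
  have : (2 * s) * ∑ a, θ (e a) * η (e a) = 0 := by linear_combination h3
  exact (mul_eq_zero.1 this).resolve_left (mul_ne_zero two_ne_zero hs)

theorem sharp_covMul {s : ℂ} (hs : s ≠ 0) {θ η : V →L[ℝ] ℂ} (hθ : ∀ v, θ (J v) = s * θ v)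
    (hη : ∀ v, η (J v) = s * η v) (α : MixedAlt V) :
    sharp e θ (covMul η α) = - covMul η (sharp e θ α) := by
  simp only [sharp_apply, contract_covMul, smul_sub, smul_smul, Finset.sum_sub_distrib,
    ← Finset.sum_smul, H.sum_mul_eq_zero hs hθ hη, zero_smul, zero_sub, map_sum, map_smul]

end IsHermitian

end Frame

/-! ### Square of the star, volume form and invariance under rotations. -/

section Star

variable {V : Type*} [NormedAddCommGroup V] [NormedSpace ℝ V]
variable {n : ℕ} {J : V →L[ℝ] V} {g : V →L[ℝ] V →L[ℝ] ℝ} {Ω : V [⋀^Fin 2]→L[ℝ] ℂ}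
  {e : Fin (2 * n) → V}

theorem one_apply_of_ne {k : ℕ} (h : k ≠ 0) : (one : MixedAlt V) k = 0 := Pi.single_eq_of_ne h _

theorem one_apply_zero (v : Fin 0 → V) : (one : MixedAlt V) 0 v = 1 := rfl

theorem pull_lefschetz {R : V →L[ℝ] V} (hR : Ω.compContinuousLinearMap R = Ω) (α : MixedAlt V) :
    pull R (lefschetz Ω α) = lefschetz Ω (pull R α) := by
  funext k
  match k with
  | 0 => rfl
  | 1 => rfl
  | k + 2 =>
    change (wedge _ _ _).compContinuousLinearMap R = wedge _ _ _
    rw [wedge_compContinuousLinearMap, hR]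
    rfl

theorem pull_lefschetz_pow {R : V →L[ℝ] V} (hR : Ω.compContinuousLinearMap R = Ω) (m : ℕ)
    (α : MixedAlt V) : pull R ((lefschetz Ω ^ m) α) = (lefschetz Ω ^ m) (pull R α) := by
  induction m with
  | zero => rfl
  | succ m ih =>
    rw [pow_succ', Module.End.mul_apply, Module.End.mul_apply, pull_lefschetz hR, ih]

theorem sharp_one (θ : V →L[ℝ] ℂ) : sharp e θ one = 0 := by
  rw [sharp_apply]
  exact Finset.sum_eq_zero fun a _ => by rw [contract_one]; ext; simp

namespace IsHermitian

variable (H : IsHermitian J g Ω e)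
include H

theorem eq_zero_of_lt {k : ℕ} (h : 2 * n < k) (β : V [⋀^Fin k]→L[ℝ] ℂ) : β = 0 := by
  have := H.fin
  ext v
  refine β.toAlternatingMap.map_linearDependent v fun hv => ?_
  have := hv.fintype_card_le_finrank
  rw [H.dim, Fintype.card_fin] at this
  omega

theorem eq_sum_single (α : MixedAlt V) :
    α = ∑ k ∈ Finset.range (2 * n + 1), Pi.single k (α k) := by
  funext k
  rw [Finset.sum_apply]
  by_cases h : k < 2 * n + 1
  · rw [Finset.sum_eq_single_of_mem k (Finset.mem_range.2 h), Pi.single_eq_same]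
    intro j _ hj
    exact Pi.single_eq_of_ne hj.symm _
  · rw [H.eq_zero_of_lt (by omega) (α k)]
    exact (H.eq_zero_of_lt (by omega) _).symm

/-- Expanding the first argument of `β` in the frame and alternating again gives `β` once for each
of the `k + 1` positions. Dividing by `k + 1` writes any form as a sum of products with covectors,
which drives `mixed_induction`. -/
theorem sum_extMul_curryLeft {k : ℕ} (β : V [⋀^Fin (k + 1)]→L[ℝ] ℂ) :
    ∑ a, extMul (flat g (e a)) (β.curryLeft (e a)) = (k + 1 : ℂ) • β := by
  have h1 : β.curryLeft = ∑ a, (flat g (e a)).smulRight (β.curryLeft (e a)) := by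
    refine ContinuousLinearMap.ext fun u => ?_
    conv_lhs => rw [← H.sum_repr u, map_sum]
    rw [sum_apply]
    refine Finset.sum_congr rfl fun a _ => ?_
    rw [map_smul]
    rfl
  have h2 := ContinuousAlternatingMap.alternatizeUncurryFin_curryLeft β
  rw [h1] at h2
  ext v
  have h3 := congrArg (fun f => f v) h2
  simp only [ContinuousAlternatingMap.alternatizeUncurryFin_apply, sum_apply,
    ContinuousAlternatingMap.sum_apply, ContinuousAlternatingMap.smul_apply, Finset.smul_sum] at h3
  rw [Finset.sum_comm] at h3
  simp only [ContinuousAlternatingMap.sum_apply, ContinuousAlternatingMap.smul_apply, extMul,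
    ContinuousAlternatingMap.alternatizeUncurryFin_apply]
  rw [h3]
  simp

/-- Mixed forms are generated by `1` under exterior multiplication by the covectors of the dual
frame. -/
theorem mixed_induction {P : MixedAlt V → Prop} (hadd : ∀ α β, P α → P β → P (α + β))
    (hsmul : ∀ (c : ℂ) α, P α → P (c • α)) (h1 : P one)
    (hcov : ∀ u β, P β → P (covMul (flat g u) β)) (α : MixedAlt V) : P α := by
  have h0 : P 0 := by
    have := hsmul 0 one h1
    rwa [show (0 : ℂ) • (one : MixedAlt V) = 0 by module] at this
  have hsum : ∀ {ι : Type} (s : Finset ι) (f : ι → MixedAlt V), (∀ i ∈ s, P (f i)) →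
      P (∑ i ∈ s, f i) := fun s f hf => Finset.sum_induction f P hadd h0 hf
  have hk : ∀ (k : ℕ) (β : V [⋀^Fin k]→L[ℝ] ℂ), P (Pi.single k β) := by
    intro k
    induction k with
    | zero =>
      intro β
      convert hsmul (β 0) one h1 using 1
      funext k
      ext v
      cases k with
      | zero =>
        simp only [Pi.smul_apply, ContinuousAlternatingMap.smul_apply, one_apply_zero, smul_eq_mul,
          mul_one, Pi.single_eq_same]
        congr 1
        exact Subsingleton.elim _ _
      | succ k => simp [one_apply_of_ne]
    | succ k ih =>
      intro β
      have hk : (k + 1 : ℂ) ≠ 0 := by exact_mod_cast Nat.succ_ne_zero k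
      convert hsmul (k + 1 : ℂ)⁻¹ _ (hsum Finset.univ
        (fun a => covMul (flat g (e a)) (Pi.single k (β.curryLeft (e a))))
        fun a _ => hcov _ _ (ih _)) using 1
      simp only [covMul_single]
      have h2 := H.sum_extMul_curryLeft β
      funext j
      rw [Pi.smul_apply, Finset.sum_apply]
      by_cases hj : j = k + 1
      · subst hj
        simp only [Pi.single_eq_same]
        rw [h2]
        ext v
        simp [hk]
      · ext v
        simp [Pi.single_eq_of_ne hj]
  rw [H.eq_sum_single α]
  exact hsum _ _ fun k _ => hk k _

theorem covectorWedge_frame : covectorWedge (fun a => flat g (e a)) e = 1 := by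
  have h : (Matrix.of fun a b => flat g (e a) (e b)) = (1 : Matrix _ _ ℂ) := by
    ext a b
    simp only [Matrix.of_apply, flat_apply, H.frame.1, Matrix.one_apply]
    split_ifs <;> simp
  rw [covectorWedge_apply, h, Matrix.det_one]

theorem hodge_one : hodge g e one = Pi.single (2 * n) (covectorWedge fun a => flat g (e a)) := by
  funext m
  by_cases h : m ≤ 2 * n
  · obtain ⟨k, hk⟩ := Nat.exists_eq_add_of_le' h
    rw [hodge_apply hk.symm]
    by_cases hm : m = 2 * n
    · subst hm
      obtain rfl : k = 0 := by omega
      rw [Pi.single_eq_same]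
      ext v
      rw [frameStar_eq_wedge H.symm]
      have : (one : MixedAlt V) 0 = ContinuousAlternatingMap.constOfIsEmpty ℝ V (Fin 0) 1 := rfl
      rw [this, wedge_const_left, one_smul, covectorWedge_apply, covectorWedge_apply,
        ← Matrix.det_transpose]
      congr 1
      ext a b
      simp [H.symm (v b)]
    · rw [Pi.single_eq_of_ne hm, one_apply_of_ne (by omega)]
      ext v
      simp [frameStar]
  · rw [hodge_apply_of_lt (by omega), Pi.single_eq_of_ne (by omega)]

theorem covMul_hodge_one (θ : V →L[ℝ] ℂ) : covMul θ (hodge g e one) = 0 := by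
  rw [H.hodge_one, covMul_single]
  funext k
  by_cases h : k = 2 * n + 1
  · subst h
    exact H.eq_zero_of_lt (by omega) _
  · rw [Pi.single_eq_of_ne h]
    rfl

/-- The counterpart of `hodge_covMul_flat`. On `1` both sides vanish, since nothing lies above
degree `2n`; under multiplication by a covector both sides pick up the same scalar `g(u, w)`. -/
theorem hodge_contract (u : V) (α : MixedAlt V) :
    hodge g e (contract u α) = - covMul (flat g u) (hodge g e (degSign α)) := by
  refine H.mixed_induction (P := fun α => hodge g e (contract u α) =
    - covMul (flat g u) (hodge g e (degSign α))) ?_ ?_ ?_ ?_ α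
  · intro α β hα hβ
    simp only [map_add, hα, hβ]
    abel
  · intro c α hα
    simp only [map_smul, hα]
    module
  · have h := degSign_covMul (flat g u) (hodge g e one)
    rw [H.covMul_hodge_one, map_zero] at h
    rw [contract_one, map_zero, ← degSign_hodge]
    exact h
  · intro w β hβ
    have h1 : contract u (degSign β) = - degSign (contract u β) := by
      rw [degSign_contract, neg_neg]
    have h2 : hodge g e (contract u (degSign β)) = - covMul (flat g u) (hodge g e β) := by
      rw [h1, map_neg, ← degSign_hodge, hβ, map_neg, neg_neg, degSign_covMul, degSign_hodge,
        degSign_degSign]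
    rw [contract_covMul, map_sub, map_smul, hodge_covMul_flat H.symm, degSign_contract, map_neg,
      map_neg, h2, degSign_covMul, map_neg, map_neg, neg_neg, hodge_covMul_flat H.symm,
      degSign_degSign, map_neg, neg_neg, contract_covMul, flat_apply, flat_apply, H.symm w u]
    abel

theorem hodge_hodge_one : hodge g e (hodge g e one) = one := by
  rw [H.hodge_one]
  funext m
  by_cases h : m ≤ 2 * n
  · obtain ⟨k, hk⟩ := Nat.exists_eq_add_of_le' h
    rw [hodge_apply hk.symm]
    by_cases hm : m = 0
    · subst hm
      obtain rfl : k = 2 * n := by omega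
      rw [Pi.single_eq_same]
      ext v
      rw [frameStar_eq_wedge H.symm, wedge_apply]
      have h1 : ∀ σ : Equiv.Perm (Fin (2 * n)), ((Equiv.Perm.sign σ : ℤ) : ℂ) *
          tensorMul hk.symm (covectorWedge fun a => flat g (e a))
            (covectorWedge fun j : Fin 0 => flat g (v j)) (e ∘ σ) = 1 := by
        intro σ
        have h2 : covectorWedge (fun a => flat g (e a)) (e ∘ σ) = 
            Equiv.Perm.sign σ • covectorWedge (fun a => flat g (e a)) e :=
          (covectorWedge fun a => flat g (e a)).toAlternatingMap.map_perm e σ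
        have h3 := H.covectorWedge_frame
        have h4 : (fun i => (e ∘ σ) (Fin.cast hk.symm (Fin.castAdd 0 i))) = e ∘ σ := rfl
        rw [tensorMul_apply, h4, h2, h3, covectorWedge_apply, Matrix.det_fin_zero]
        rcases Int.units_eq_one_or (Equiv.Perm.sign σ) with h | h <;> simp [h]
      rw [Finset.sum_congr rfl fun σ _ => h1 σ, one_apply_zero]
      have hl : ((2 * n).factorial : ℂ) ≠ 0 := by exact_mod_cast (2 * n).factorial_ne_zero
      simp [Fintype.card_perm, hl]
    · rw [Pi.single_eq_of_ne (by omega), one_apply_of_ne (by omega)]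
      ext v
      simp [frameStar]
  · rw [hodge_apply_of_lt (by omega), one_apply_of_ne (by omega)]

/-- Applying the star twice turns exterior multiplication into contraction and back, up to the sign
from the degree; only `**1 = 1` has to be computed. -/
theorem hodge_hodge (α : MixedAlt V) : hodge g e (hodge g e α) = degSign α := by
  refine H.mixed_induction (P := fun α => hodge g e (hodge g e α) = degSign α) ?_ ?_ ?_ ?_ α
  · intro α β hα hβ
    simp only [map_add, hα, hβ]
  · intro c α hα
    simp only [map_smul, hα]
  · rw [H.hodge_hodge_one, one, degSign_single]
    simp
  · intro u β hβ
    rw [hodge_covMul_flat H.symm, H.hodge_contract, degSign_hodge, degSign_degSign, hβ,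
      degSign_covMul]

theorem rotation_inv (t : ℝ) (v : V) : rotation J t (rotation J (-t) v) = v := by
  simp only [rotation, add_apply, smul_apply, ContinuousLinearMap.id_apply, map_add, map_smul,
    Real.cos_neg, Real.sin_neg, H.J_J]
  have := Real.sin_sq_add_cos_sq t
  match_scalars
  · linear_combination this
  · ring

theorem g_rotation (t : ℝ) (u v : V) : g (rotation J t u) (rotation J t v) = g u v := by
  simp only [rotation, add_apply, smul_apply, ContinuousLinearMap.id_apply, map_add, map_smul,
    smul_eq_mul, H.g_J, H.g_J_left]
  linear_combination g u v * Real.sin_sq_add_cos_sq t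

theorem omega_rotation (t : ℝ) : Ω.compContinuousLinearMap (rotation J t) = Ω := by
  ext v
  have : J (rotation J t (v 0)) = rotation J t (J (v 0)) := by
    simp [rotation]
  rw [ContinuousAlternatingMap.compContinuousLinearMap_apply, H.omega_apply, H.omega_apply]
  simp only [Function.comp_apply]
  rw [this, H.g_rotation]

/-- `L^j 1` evaluated on the last `2j` vectors of the frame. -/
theorem lefschetz_pow_one_apply (j : ℕ) (hj : j ≤ n) :
    (lefschetz Ω ^ j) one (2 * j) (fun i => e ⟨2 * (n - j) + i, by omega⟩) = j.factorial := by
  induction j with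
  | zero => simp [one]
  | succ j ih =>
    set w : Fin (2 * j + 2) → V := fun i => e ⟨2 * (n - (j + 1)) + i, by omega⟩ with hw
    have h0 : w = Fin.cons (w 0) (Fin.tail w) := (Fin.cons_self_tail w).symm
    have h1 : J (w 0) = w 1 := (H.frame.2 ⟨n - (j + 1), by omega⟩).symm
    -- Contracting with `w 0` leaves `(j + 1) g(J (w 0), ·) ∧ L^j 1`. Since `J (w 0) = w 1` is
    -- orthogonal to the later vectors, only the first term of the expansion survives.
    have h2 := congrArg (fun f => f (Fin.tail w))
      (congrFun (H.contract_lefschetz_pow (w 0) j one) (2 * j + 1))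
    rw [contract_one, map_zero, zero_add, ← H.covMul_lefschetz_pow] at h2
    simp only [contract_apply] at h2
    rw [← h0] at h2
    change (lefschetz Ω ^ (j + 1)) one (2 * j + 1 + 1) w = _
    rw [h2, Pi.smul_apply, ContinuousAlternatingMap.smul_apply, covMul_succ, extMul_apply,
      Finset.sum_eq_single 0]
    · have h3 : flat g (J (w 0)) (Fin.tail w 0) = 1 := by
        rw [h1]
        change (g (w 1) (w 1) : ℂ) = 1
        simp [hw, H.frame.1]
      have h4 : (Fin.removeNth 0 (Fin.tail w)) =
          fun i : Fin (2 * j) => e ⟨2 * (n - j) + i, by omega⟩ := by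
        funext i
        simp only [Fin.removeNth, Fin.tail, hw]
        congr 1
        ext
        simp
        omega
      rw [h3, h4, ih (by omega), Nat.factorial_succ]
      simp
    · intro b _ hb
      have h3 : flat g (J (w 0)) (Fin.tail w b) = 0 := by
        rw [h1]
        change (g (w 1) (w b.succ) : ℂ) = 0
        simp only [hw, H.frame.1]
        rw [if_neg]
        · simp
        · intro h5
          have h6 := congrArg Fin.val h5
          simp only [Fin.val_succ, Fin.val_one] at h6
          exact hb (Fin.ext (by rw [Fin.val_zero]; omega))
      rw [h3]
      simp
    · simp

theorem top_ext {α β : V [⋀^Fin (2 * n)]→L[ℝ] ℂ} (h : α e = β e) : α = β := by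
  have := H.fin
  have hli : LinearIndependent ℝ e := by
    rw [Fintype.linearIndependent_iff]
    intro c hc i
    have := congrArg (g (e i)) hc
    simpa [H.frame.1] using this
  let b := basisOfLinearIndependentOfCardEqFinrank' e hli (by simp [H.dim])
  refine ContinuousAlternatingMap.toAlternatingMap_injective (Module.Basis.ext_alternating b ?_)
  intro v hv
  let σ : Equiv.Perm (Fin (2 * n)) := Equiv.ofBijective v (Finite.injective_iff_bijective.1 hv)
  have hσ : (fun i => b (v i)) = e ∘ σ := by
    funext i
    simp [b, σ]
  rw [hσ, AlternatingMap.map_perm, AlternatingMap.map_perm]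
  congr 1

/-- A top form is determined by its value on the frame (`top_ext`). The volume form has value `1`
and `ω^n` has value `n!`; the order `e, Je` in the frame fixes the sign. -/
theorem hodge_one_eq : hodge g e one = (n.factorial : ℂ)⁻¹ • (lefschetz Ω ^ n) one := by
  have hn : (n.factorial : ℂ) ≠ 0 := by exact_mod_cast n.factorial_ne_zero
  obtain ⟨γ, hγ⟩ := lefschetz_pow_single (Ω := Ω) n
    (ContinuousAlternatingMap.constOfIsEmpty ℝ V (Fin 0) (1 : ℂ))
  have h1 : (lefschetz Ω ^ n) one = Pi.single (2 * n) ((lefschetz Ω ^ n) one (2 * n)) := by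
    funext k
    by_cases h : k = 2 * n
    · subst h; simp
    · rw [Pi.single_eq_of_ne h]
      rw [one, hγ, Pi.single_eq_of_ne (by omega)]
  have h2 := H.lefschetz_pow_one_apply n le_rfl
  have h3 : (lefschetz Ω ^ n) one (2 * n) e = n.factorial := by
    rw [← h2]
    congr 1
    funext i
    congr 1
    ext
    simp
  rw [H.hodge_one, h1]
  funext k
  by_cases h : k = 2 * n
  · subst h
    rw [Pi.smul_apply, Pi.single_eq_same, Pi.single_eq_same]
    refine H.top_ext ?_
    rw [ContinuousAlternatingMap.smul_apply, h3, H.covectorWedge_frame, smul_eq_mul,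
      inv_mul_cancel₀ hn]
  · rw [Pi.smul_apply, Pi.single_eq_of_ne h, Pi.single_eq_of_ne h]
    ext; simp

/-- The volume form is a multiple of `ω^n`, and `ω` is invariant under rotations, which settles `α =
1`. For covectors, rotations are isometries, so pulling back `g(u, ·)` amounts to rotating `u` back.
This is how the star is seen to preserve the weight `p - q`. -/
theorem hodge_pull_rotation (t : ℝ) (α : MixedAlt V) :
    hodge g e (pull (rotation J t) α) = pull (rotation J t) (hodge g e α) := by
  set R := rotation J t with hR
  have hΩ : Ω.compContinuousLinearMap R = Ω := H.omega_rotation t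
  refine H.mixed_induction (P := fun α => hodge g e (pull R α) = pull R (hodge g e α))
    ?_ ?_ ?_ ?_ α
  · intro α β hα hβ
    simp only [map_add, hα, hβ]
  · intro c α hα
    simp only [map_smul, hα]
  · rw [pull_one, H.hodge_one_eq, map_smul, pull_lefschetz_pow hΩ, pull_one]
  · intro u β hβ
    have h1 : (flat g u).comp R = flat g (rotation J (-t) u) := by
      ext v
      have h2 := H.g_rotation t (rotation J (-t) u) v
      rw [H.rotation_inv] at h2
      simp [h2, hR]
    have h3 : hodge g e (pull R (degSign β)) = pull R (hodge g e (degSign β)) := by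
      rw [← degSign_pull, ← degSign_hodge, hβ, degSign_pull, degSign_hodge]
    rw [pull_covMul, h1, hodge_covMul_flat H.symm, hodge_covMul_flat H.symm, degSign_pull, h3,
      contract_pull, hR, H.rotation_inv]

end IsHermitian

end Star

/-! ### Forms of bidegree `(k, 0)` and `(0, k)`, and bidegrees as weights. -/

section PureTypes

variable {V : Type*} [NormedAddCommGroup V] [NormedSpace ℝ V]
variable {n : ℕ} {J : V →L[ℝ] V} {g : V →L[ℝ] V →L[ℝ] ℝ} {Ω : V [⋀^Fin 2]→L[ℝ] ℂ}
  {e : Fin (2 * n) → V}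

/-- The constant `c` in `*α = c L^{n-k} α`, for a product `α` of `k` covectors with `θ ∘ J = s θ`. -/
def hodgeConst (n : ℕ) (s : ℂ) : ℕ → ℂ
  | 0 => (n.factorial : ℂ)⁻¹
  | k + 1 => (-1) ^ k * hodgeConst n s k * (-(((n - k : ℕ) : ℂ) * s))

theorem hodgeConst_ne_zero {s : ℂ} (hs : s ≠ 0) {k : ℕ} (hk : k ≤ n) : hodgeConst n s k ≠ 0 := by
  induction k with
  | zero => exact inv_ne_zero (by exact_mod_cast n.factorial_ne_zero)
  | succ k ih =>
    have h : ((n - k : ℕ) : ℂ) ≠ 0 := by exact_mod_cast (by omega : n - k ≠ 0)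
    simp only [hodgeConst]
    exact mul_ne_zero (mul_ne_zero (pow_ne_zero _ (by norm_num)) (ih (by omega)))
      (neg_ne_zero.2 (mul_ne_zero h hs))

/-- The contraction anticommutes past each factor by isotropy and finally meets `1`. -/
theorem IsHermitian.sharp_covectorWedge (H : IsHermitian J g Ω e) {s : ℂ} (hs : s ≠ 0)
    {θ : V →L[ℝ] ℂ} (hθ : ∀ v, θ (J v) = s * θ v) {k : ℕ} (η : Fin k → V →L[ℝ] ℂ)
    (hη : ∀ a v, η a (J v) = s * η a v) :
    sharp e θ (Pi.single k (covectorWedge η)) = 0 := by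
  induction k with
  | zero => rw [single_covectorWedge_zero, sharp_one]
  | succ k ih =>
    rw [single_covectorWedge_succ, H.sharp_covMul hs hθ (hη 0), ih (Fin.tail η) fun a v => hη a.succ v,
      map_zero]
    exact neg_zero

/-- Split off the first covector `θ`, so that the star becomes contraction with its dual vector
applied to `L^{n-k}` of the remaining product. The contraction kills that product, so only the
commutator with `L^{n-k}` remains. It contributes `-(n-k) s`, and the degree sign contributes
`(-1)^k`: these are the factors in `hodgeConst`. -/
theorem IsHermitian.hodge_covectorWedge (H : IsHermitian J g Ω e) {s : ℂ} (hs : s ≠ 0)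
    {k : ℕ} (hk : k ≤ n) (η : Fin k → V →L[ℝ] ℂ) (hη : ∀ a v, η a (J v) = s * η a v) :
    hodge g e (Pi.single k (covectorWedge η)) =
      hodgeConst n s k • (lefschetz Ω ^ (n - k)) (Pi.single k (covectorWedge η)) := by
  induction k with
  | zero => rw [single_covectorWedge_zero, H.hodge_one_eq]; rfl
  | succ k ih =>
    obtain ⟨m, hm⟩ : ∃ m, n - k = m + 1 := ⟨n - k - 1, by omega⟩
    have hm' : n - (k + 1) = m := by omega
    have hη' : ∀ a v, Fin.tail η a (J v) = s * Fin.tail η a v := fun a v => hη a.succ v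
    rw [single_covectorWedge_succ, H.hodge_covMul, degSign_single, map_smul, ih (by omega) _ hη',
      map_smul, map_smul, hm, H.sharp_lefschetz_pow (hη 0), H.sharp_covectorWedge hs (hη 0) _ hη',
      map_zero, hm', hodgeConst, hm]
    push_cast
    module

/-- The constant `c` in `*α = c L^{n-k} α`, for `α` of bidegree `(a, b)` with `a = 0` or `b = 0`. -/
def pureConst (n a b : ℕ) : ℂ :=
  if b = 0 then hodgeConst n Complex.I a else hodgeConst n (-Complex.I) b

theorem pureConst_ne_zero {a b : ℕ} (h : a + b ≤ n) : pureConst n a b ≠ 0 := by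
  unfold pureConst
  split_ifs
  · exact hodgeConst_ne_zero Complex.I_ne_zero (by omega)
  · exact hodgeConst_ne_zero (neg_ne_zero.2 Complex.I_ne_zero) (by omega)

theorem IsHermitian.hodge_single_of_mem (H : IsHermitian J g Ω e) {a b k : ℕ} (hab : a = 0 ∨ b = 0)
    (hk : k ≤ n) {α : V [⋀^Fin k]→L[ℝ] ℂ} (hα : α ∈ typeForms J a b k) :
    hodge g e (Pi.single k α) =
      pureConst n a b • (lefschetz Ω ^ (n - k)) (Pi.single k α) := by
  induction hα using Submodule.span_induction with
  | mem α h =>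
    obtain ⟨S, θ, hS, hS', h1, h2, rfl⟩ := h
    by_cases hb : b = 0
    · have hS0 : Sᶜ = ∅ := Finset.card_eq_zero.1 (hS'.trans hb)
      have hSu : S = Finset.univ := by rwa [Finset.compl_eq_empty_iff] at hS0
      have hka : k = a := by rw [← hS, hSu]; simp
      subst hka
      rw [pureConst, if_pos hb]
      exact H.hodge_covectorWedge Complex.I_ne_zero hk θ fun a v => h1 a (by simp [hSu]) v
    · have ha : a = 0 := hab.resolve_right hb
      have hS0 : S = ∅ := Finset.card_eq_zero.1 (hS.trans ha)
      have hkb : k = b := by rw [← hS', hS0]; simp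
      subst hkb
      rw [pureConst, if_neg hb]
      exact H.hodge_covectorWedge (neg_ne_zero.2 Complex.I_ne_zero) hk θ
        fun a v => h2 a (by simp [hS0]) v
  | zero =>
    rw [Pi.single_zero, map_zero, map_zero]
    module
  | add α β _ _ hα hβ =>
    rw [Pi.single_add, map_add, map_add, hα, hβ]
    module
  | smul c α _ hα =>
    have : (Pi.single k (c • α) : MixedAlt V) = c • Pi.single k α := by
      funext j
      by_cases h : j = k
      · subst h; simp
      · rw [Pi.smul_apply, Pi.single_eq_of_ne h, Pi.single_eq_of_ne h]
        ext; simp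
    rw [this, map_smul, map_smul, hα]
    module

theorem rotation_comm (J : V →L[ℝ] V) (s t : ℝ) (v : V) :
    rotation J s (rotation J t v) = rotation J t (rotation J s v) := by
  simp only [rotation, add_apply, smul_apply, ContinuousLinearMap.id_apply, map_add, map_smul]
  module

theorem typeProj_comp_rotation (J : V →L[ℝ] V) (p q : ℕ) {k : ℕ} (α : V [⋀^Fin k]→L[ℝ] ℂ) (t : ℝ) :
    typeProj J p q (α.compContinuousLinearMap (rotation J t)) =
      (typeProj J p q α).compContinuousLinearMap (rotation J t) := by
  unfold typeProj
  split_ifs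
  · ext v
    simp [Function.comp_def, rotation_comm J t]
  · rfl

theorem typeProj_eq_zero_of_weight [FiniteDimensional ℝ V] (hJ : ∀ v, J (J v) = -v) {p q k : ℕ}
    {w : ℝ} {α : V [⋀^Fin k]→L[ℝ] ℂ}
    (hα : ∀ t : ℝ, α.compContinuousLinearMap (rotation J t) =
      Complex.exp (t * w * Complex.I) • α) (hw : (p : ℝ) - q ≠ w) : typeProj J p q α = 0 := by
  have hw' : w - ((p : ℝ) - q) ≠ 0 := sub_ne_zero.2 hw.symm
  -- At this angle the characters of weights `w` and `p - q` take opposite values, so the projection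
  -- equals its own negative.
  set t : ℝ := Real.pi / (w - (p - q)) with ht
  have h1 := comp_rotation_of_mem (typeProj_mem hJ p q α) t
  rw [← typeProj_comp_rotation, hα, typeProj_smul] at h1
  have h2 : Complex.exp (t * w * Complex.I) =
      - Complex.exp (t * ((p : ℂ) - q) * Complex.I) := by
    have h3 : (t : ℂ) * w * Complex.I =
        t * ((p : ℂ) - q) * Complex.I + Real.pi * Complex.I := by
      have h4 : t * (w - (p - q)) = Real.pi := by rw [ht]; field_simp
      have h5 : (t : ℂ) * (w - (p - q)) = Real.pi := by exact_mod_cast h4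
      linear_combination Complex.I * h5
    rw [h3, Complex.exp_add, Complex.exp_pi_mul_I]
    ring
  rw [h2] at h1
  ext v
  have h6 := congrArg (fun f => f v) h1
  simp only [ContinuousAlternatingMap.smul_apply, smul_eq_mul] at h6
  have h7 : Complex.exp (t * ((p : ℂ) - q) * Complex.I) * typeProj J p q α v = 0 := by
    linear_combination (-1 / 2 : ℂ) * h6
  exact (mul_eq_zero.1 h7).resolve_left (Complex.exp_ne_zero _)

/-- In a fixed degree the weight `p - q` determines `(p, q)`, so every other component vanishes. -/
theorem mem_typeForms_of_weight [FiniteDimensional ℝ V] (hJ : ∀ v, J (J v) = -v) {p q k : ℕ}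
    (hk : p + q = k) {α : V [⋀^Fin k]→L[ℝ] ℂ}
    (hα : ∀ t : ℝ, α.compContinuousLinearMap (rotation J t) =
      Complex.exp (t * ((p : ℝ) - q : ℝ) * Complex.I) • α) : α ∈ typeForms J p q k := by
  have h := sum_typeProj hJ α
  rw [Finset.sum_eq_single_of_mem (p, q) (Finset.HasAntidiagonal.mem_antidiagonal.2 hk)] at h
  · rw [← h]
    exact typeProj_mem hJ p q α
  · rintro ⟨p', q'⟩ hpq hne
    rw [Finset.HasAntidiagonal.mem_antidiagonal] at hpq
    refine typeProj_eq_zero_of_weight hJ hα fun h0 => hne ?_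
    have h1 : (p' : ℤ) - q' = p - q := by exact_mod_cast h0
    simp only at hpq
    ext <;> simp <;> omega

/-- The weights occurring in degree `k` are `p - q` with `p + q = k`, all of absolute value at most
`k`. -/
theorem eq_zero_of_weight [FiniteDimensional ℝ V] (hJ : ∀ v, J (J v) = -v) {k : ℕ} {w : ℤ}
    (hw : k < |w|) {α : V [⋀^Fin k]→L[ℝ] ℂ}
    (hα : ∀ t : ℝ, α.compContinuousLinearMap (rotation J t) =
      Complex.exp (t * ((w : ℝ) : ℂ) * Complex.I) • α) : α = 0 := by
  rw [← sum_typeProj hJ α]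
  refine Finset.sum_eq_zero ?_
  rintro ⟨p, q⟩ hpq
  rw [Finset.HasAntidiagonal.mem_antidiagonal] at hpq
  refine typeProj_eq_zero_of_weight hJ hα fun h0 => ?_
  have h1 : (p : ℤ) - q = w := by exact_mod_cast h0
  simp only at hpq
  rw [lt_abs] at hw
  omega

/-- A mixed form is homogeneous of bidegree `(a, b)`. -/
def IsOfType (J : V →L[ℝ] V) (a b : ℕ) (α : MixedAlt V) : Prop :=
  α (a + b) ∈ typeForms J a b (a + b) ∧ ∀ k, k ≠ a + b → α k = 0

theorem IsOfType.eq_single {a b : ℕ} {α : MixedAlt V} (h : IsOfType J a b α) :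
    α = Pi.single (a + b) (α (a + b)) := by
  funext k
  by_cases hk : k = a + b
  · subst hk; simp
  · rw [h.2 k hk, Pi.single_eq_of_ne hk]

theorem IsOfType.pull_rotation {a b : ℕ} {α : MixedAlt V} (h : IsOfType J a b α) (t : ℝ) :
    pull (rotation J t) α = Complex.exp (t * ((a : ℂ) - b) * Complex.I) • α := by
  funext k
  by_cases hk : k = a + b
  · subst hk
    exact comp_rotation_of_mem h.1 t
  · rw [Pi.smul_apply, h.2 k hk]
    change (α k).compContinuousLinearMap _ = _
    rw [h.2 k hk]
    ext; simp

theorem isOfType_of_pull_rotation [FiniteDimensional ℝ V] (hJ : ∀ v, J (J v) = -v) {a b : ℕ}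
    {α : MixedAlt V} (h0 : ∀ k, k ≠ a + b → α k = 0)
    (h : ∀ t, pull (rotation J t) α = Complex.exp (t * ((a : ℂ) - b) * Complex.I) • α) :
    IsOfType J a b α :=
  ⟨mem_typeForms_of_weight hJ rfl fun t => by
    have := congrFun (h t) (a + b)
    push_cast
    exact this, h0⟩

theorem IsOfType.hodge_apply_eq_zero {a b : ℕ} {α : MixedAlt V} (hα : IsOfType J a b α)
    {m : ℕ} (hm : a + b + m ≠ 2 * n) : hodge g e α m = 0 := by
  by_cases h : m ≤ 2 * n
  · obtain ⟨k, hk⟩ := Nat.exists_eq_add_of_le' h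
    rw [hodge_apply hk.symm, hα.2 k (by omega)]
    ext; simp [frameStar]
  · exact hodge_apply_of_lt (by omega) α

namespace IsHermitian

variable (H : IsHermitian J g Ω e)
include H

theorem hodge_of_isOfType {a b : ℕ} (hab : a = 0 ∨ b = 0) (hk : a + b ≤ n) {α : MixedAlt V}
    (hα : IsOfType J a b α) :
    hodge g e α = pureConst n a b • (lefschetz Ω ^ (n - (a + b))) α := by
  rw [hα.eq_single]
  exact H.hodge_single_of_mem hab hk hα.1

theorem isOfType_lefschetz_pow {a b : ℕ} {α : MixedAlt V} (hα : IsOfType J a b α) (m : ℕ) :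
    IsOfType J (a + m) (b + m) ((lefschetz Ω ^ m) α) := by
  have := H.fin
  refine isOfType_of_pull_rotation H.J_J (fun k hk => ?_) fun t => ?_
  · rw [hα.eq_single]
    obtain ⟨γ, hγ⟩ := lefschetz_pow_single (Ω := Ω) m (α (a + b))
    rw [hγ, Pi.single_eq_of_ne (by omega)]
  · rw [pull_lefschetz_pow (H.omega_rotation t), hα.pull_rotation, map_smul]
    push_cast
    congr 3
    ring

/-- The weight `a - b` is kept and the degree becomes `2n - a - b`; the only bidegree with these two
numbers is `(n - b, n - a)`. -/
theorem isOfType_hodge {a b : ℕ} (ha : a ≤ n) (hb : b ≤ n) {α : MixedAlt V}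
    (hα : IsOfType J a b α) : IsOfType J (n - b) (n - a) (hodge g e α) := by
  have := H.fin
  refine isOfType_of_pull_rotation H.J_J (fun k hk => ?_) fun t => ?_
  · exact hα.hodge_apply_eq_zero (by omega)
  · rw [← H.hodge_pull_rotation, hα.pull_rotation, map_smul]
    push_cast [Nat.cast_sub ha, Nat.cast_sub hb]
    congr 3
    ring

/-- The image would have weight `a - b` in degree `2n - a - b`, and `|a - b|` exceeds that degree as
soon as `a` or `b` exceeds `n`. -/
theorem hodge_eq_zero {a b : ℕ} (hab : n < a ∨ n < b) {α : MixedAlt V}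
    (hα : IsOfType J a b α) : hodge g e α = 0 := by
  have := H.fin
  funext m
  by_cases hm : a + b + m = 2 * n
  · refine eq_zero_of_weight H.J_J (w := a - b) (by rw [lt_abs]; omega) fun t => ?_
    have h := congrFun (H.hodge_pull_rotation t α) m
    rw [hα.pull_rotation, map_smul] at h
    push_cast
    exact h.symm
  · exact hα.hodge_apply_eq_zero hm

/-- Primitivity for free: `L * α` has bidegree `(n - b + 1, n - a + 1)`, and one of these numbers is
`n + 1`. -/
theorem hodge_lefschetz_hodge {a b : ℕ} (hab : a = 0 ∨ b = 0) (hk : a + b ≤ n) {α : MixedAlt V}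
    (hα : IsOfType J a b α) : hodge g e (lefschetz Ω (hodge g e α)) = 0 := by
  have h := H.isOfType_lefschetz_pow (H.isOfType_hodge (by omega) (by omega) hα) 1
  rw [pow_one] at h
  exact H.hodge_eq_zero (by omega) h

end IsHermitian

end PureTypes

/-! ### The operators `∂`, `∂̄` and their Laplacians under the star. -/

section Homogeneity

variable {n : ℕ} {X : Type*} [TopologicalSpace X] [ChartedSpace (Model n) X]

/-- For an invertible constant the derivative rule needs no differentiability, so the identity holds
for arbitrary forms, smooth or not. In particular it applies to stars of forms without knowing that
they are smooth. -/
theorem Form.d_smul {k : ℕ} {c : ℂ} (hc : c ≠ 0) (α : Form n X k) :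
    Form.d (fun x => c • α x) = fun x => c • Form.d α x := by
  funext x
  have h1 : Form.inChart (fun x => c • α x) x = c • α.inChart x := rfl
  have h2 : ∀ (f : Model n → Model n [⋀^Fin k]→L[ℝ] ℂ) (y : Model n), extDeriv (c • f) y =
      c • extDeriv f y := by
    intro f y
    have : Invertible c := invertibleOfNonzero hc
    rw [extDeriv, extDeriv, fderiv_const_smul_of_invertible,
      ContinuousAlternatingMap.alternatizeUncurryFin_smul]
  rw [Form.d, h1, h2]
  rfl

/-- A mixed form at a point. -/
def MixedForm.at (α : MixedForm n X) (x : X) : MixedAlt (Model n) := fun k => α k x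

theorem MixedForm.ext_at {α β : MixedForm n X} (h : ∀ x, α.at x = β.at x) : α = β :=
  funext fun k => funext fun x => congrFun (h x) k

/-- The sign operator `(-1)^deg`. -/
def sgn (α : MixedForm n X) : MixedForm n X := fun k => (-1 : ℂ) ^ k • α k

theorem at_sgn (α : MixedForm n X) (x : X) : (sgn α).at x = degSign (α.at x) := rfl

/-- The properties of `∂` and `∂̄` that make the Hodge star intertwine their Laplacians. -/
structure IsHomogeneous (D : MixedForm n X → MixedForm n X) : Prop where
  smul : ∀ {c : ℂ}, c ≠ 0 → ∀ α, D (c • α) = c • D α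
  sgn : ∀ α, D (sgn α) = -sgn (D α)

/-- Constant `c` gives compatibility with scalars; `c k = (-1)^k` gives the sign rule, the extra
minus coming from the shift of degree by one. -/
theorem isHomogeneous_of_degSmul {D : MixedForm n X → MixedForm n X}
    (h0 : ∀ α, D α 0 = 0) (h : ∀ {c : ℕ → ℂ}, (∀ k, c k ≠ 0) → ∀ (α : MixedForm n X) (k : ℕ),
      D (fun k => c k • α k) (k + 1) = c k • D α (k + 1)) : IsHomogeneous D where
  smul {c} hc α := by
    funext k
    cases k with
    | zero =>
      rw [Pi.smul_apply, h0, h0]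
      funext x
      ext v
      simp
    | succ k => exact h (c := fun _ => c) (fun _ => hc) α k
  sgn α := by
    funext k
    cases k with
    | zero =>
      simp only [AlmostHermitian.sgn, Pi.neg_apply]
      rw [h0, h0]
      funext x
      ext v
      simp
    | succ k =>
      refine (h (c := fun k => (-1) ^ k) (fun k => pow_ne_zero _ (by norm_num)) α k).trans ?_
      simp only [AlmostHermitian.sgn, Pi.neg_apply, pow_succ]
      funext x
      ext v
      simp

theorem IsHomogeneous.neg {D : MixedForm n X → MixedForm n X} (hD : IsHomogeneous D)
    (α : MixedForm n X) : D (-α) = -D α := by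
  have h := hD.smul (c := -1) (by norm_num) α
  have h1 : ∀ β : MixedForm n X, (-1 : ℂ) • β = -β := fun β => by
    funext k x
    ext v
    simp
  rwa [h1, h1] at h

end Homogeneity

end AlmostHermitian

namespace AlmostHermitianStructure

open AlmostHermitian

variable {n : ℕ} {X : Type*} [TopologicalSpace X] [ChartedSpace (Model n) X]
  [IsManifold (𝓡 (2 * n)) ∞ X] (A : AlmostHermitianStructure n X)

theorem isHermitian (x : X) : IsHermitian (V := Model n) (A.J x) (A.g.inner x)
    (A.fundamentalForm x) (A.frame x) where
  dim := by simp
  fin := inferInstance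
  J_J := A.J_J x
  symm := A.g.symm x
  g_J := A.g_J x
  omega_apply _ := rfl
  frame := (A.exists_frame x).choose_spec

theorem at_star (α : MixedForm n X) (x : X) : (A.star α).at x =
    hodge (V := Model n) (A.g.inner x) (A.frame x) (α.at x) := rfl

theorem at_L (α : MixedForm n X) (x : X) : (A.L α).at x =
    lefschetz (V := Model n) (A.fundamentalForm x) (α.at x) := by
  funext k
  match k with
  | 0 => rfl
  | 1 => rfl
  | k + 2 => rfl

theorem at_L_iterate (α : MixedForm n X) (x : X) (m : ℕ) : (A.L^[m] α).at x =
    (lefschetz (V := Model n) (A.fundamentalForm x) ^ m) (α.at x) := by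
  induction m with
  | zero => rfl
  | succ m ih => rw [Function.iterate_succ_apply', at_L, ih, pow_succ', Module.End.mul_apply]

theorem star_star (α : MixedForm n X) : A.star (A.star α) = sgn α :=
  MixedForm.ext_at fun x => by
    rw [at_star, at_star]
    exact (A.isHermitian x).hodge_hodge _

theorem star_smul (c : ℂ) (α : MixedForm n X) : A.star (c • α) = c • A.star α :=
  MixedForm.ext_at fun x => map_smul (hodge (V := Model n) (A.g.inner x) (A.frame x)) c (α.at x)

theorem star_add (α β : MixedForm n X) : A.star (α + β) = A.star α + A.star β :=
  MixedForm.ext_at fun x => map_add (hodge (V := Model n) (A.g.inner x) (A.frame x))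
    (α.at x) (β.at x)

theorem star_neg (α : MixedForm n X) : A.star (-α) = -A.star α :=
  MixedForm.ext_at fun x => map_neg (hodge (V := Model n) (A.g.inner x) (A.frame x)) (α.at x)

theorem star_zero : A.star (0 : MixedForm n X) = 0 :=
  MixedForm.ext_at fun x => map_zero (hodge (V := Model n) (A.g.inner x) (A.frame x))

theorem star_sgn (α : MixedForm n X) : A.star (sgn α) = sgn (A.star α) :=
  MixedForm.ext_at fun x => by
    rw [at_star, at_sgn, at_sgn, at_star]
    exact (degSign_hodge (V := Model n) (g := A.g.inner x) (e := A.frame x) (α.at x)).symm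

theorem typeProj_d_smul (p q p' q' : ℕ) {k : ℕ} {c : ℂ} (hc : c ≠ 0) (α : Form n X k) (x : X) :
    typeProj (A.J x) p q (Form.d (fun y => typeProj (A.J y) p' q' (c • α y)) x) =
      c • typeProj (A.J x) p q (Form.d (fun y => typeProj (A.J y) p' q' (α y)) x) := by
  simp only [typeProj_smul]
  rw [Form.d_smul hc, typeProj_smul]

/-- `∂` and `∂̄` commute with the scalings by nonzero constants depending on the degree. -/
theorem del_degSmul {c : ℕ → ℂ} (hc : ∀ k, c k ≠ 0) (α : MixedForm n X) (k : ℕ) :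
    A.del (fun k => c k • α k) (k + 1) = c k • A.del α (k + 1) := by
  funext x
  simp only [del, Finset.sum_apply, Pi.smul_apply, A.typeProj_d_smul _ _ _ _ (hc k) (α k),
    Finset.smul_sum]

theorem delbar_degSmul {c : ℕ → ℂ} (hc : ∀ k, c k ≠ 0) (α : MixedForm n X) (k : ℕ) :
    A.delbar (fun k => c k • α k) (k + 1) = c k • A.delbar α (k + 1) := by
  funext x
  simp only [delbar, Finset.sum_apply, Pi.smul_apply, A.typeProj_d_smul _ _ _ _ (hc k) (α k),
    Finset.smul_sum]

theorem isHomogeneous_del : IsHomogeneous A.del :=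
  isHomogeneous_of_degSmul (fun _ => rfl) fun hc => A.del_degSmul hc

theorem isHomogeneous_delbar : IsHomogeneous A.delbar :=
  isHomogeneous_of_degSmul (fun _ => rfl) fun hc => A.delbar_degSmul hc

/-- The Laplacian `D D' + D' D` with `D' = -* E *`. -/
def laplacian (D E : MixedForm n X → MixedForm n X) (α : MixedForm n X) : MixedForm n X :=
  D (-A.star (E (A.star α))) + -A.star (E (A.star (D α)))

/-- After replacing `**` by the degree sign and moving that sign past `D` and `E`, the two summands
of one Laplacian become those of the other in reverse order. Additivity of `D` and `E`, which would
require smoothness, is not used. -/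
theorem laplacian_star {D E : MixedForm n X → MixedForm n X} (hD : IsHomogeneous D)
    (hE : IsHomogeneous E) (α : MixedForm n X) :
    A.laplacian E D (A.star α) = A.star (A.laplacian D E α) := by
  simp only [laplacian, star_add, star_neg, star_star, hD.sgn, hD.neg, hE.sgn,
    neg_neg, star_sgn]
  exact add_comm _ _

theorem laplacian_smul {D E : MixedForm n X → MixedForm n X} (hD : IsHomogeneous D)
    (hE : IsHomogeneous E) {c : ℂ} (hc : c ≠ 0) (α : MixedForm n X) :
    A.laplacian D E (c • α) = c • A.laplacian D E α := by
  have h1 : ∀ β : MixedForm n X, -(c • β) = c • (-β) := fun β => by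
    funext k x
    ext v
    simp
  have h2 : ∀ β γ : MixedForm n X, c • (β + γ) = c • β + c • γ := fun β γ => by
    funext k x
    ext v
    simp
  simp only [laplacian, star_smul, hD.smul hc, hE.smul hc, h1, h2]

end AlmostHermitianStructure

/-! ### Smooth families of forms and of linear systems. -/

namespace AlmostHermitian

section SmoothFamilies

variable {V : Type*} [NormedAddCommGroup V] [NormedSpace ℝ V] [FiniteDimensional ℝ V]

/-- The values of an alternating form on the tuples of basis vectors. -/
def basisEval (V : Type*) [NormedAddCommGroup V] [NormedSpace ℝ V] [FiniteDimensional ℝ V]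
    (k : ℕ) : (V [⋀^Fin k]→L[ℝ] ℂ) →ₗ[ℝ] (Fin k → Fin (Module.finrank ℝ V)) → ℂ where
  toFun α s := α fun i => Module.finBasis ℝ V (s i)
  map_add' _ _ := rfl
  map_smul' _ _ := rfl

theorem basisEval_injective (k : ℕ) : Function.Injective (basisEval V k) := by
  intro α β h
  have : α.toAlternatingMap = β.toAlternatingMap :=
    (Module.finBasis ℝ V).ext_alternating fun s _ => congrFun h s
  ext v
  exact DFunLike.congr_fun this v

instance finiteDimensional_alternating (k : ℕ) : FiniteDimensional ℝ (V [⋀^Fin k]→L[ℝ] ℂ) :=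
  FiniteDimensional.of_injective _ (basisEval_injective k)

variable {E : Type*} [NormedAddCommGroup E] [NormedSpace ℝ E] {H : Type*} [TopologicalSpace H]
  {I : ModelWithCorners ℝ E H} {M : Type*} [TopologicalSpace M] [ChartedSpace H M] {x₀ : M}
  {r : WithTop ℕ∞}

/-- Evaluation on tuples of basis vectors embeds the forms linearly into a finite product and has a
linear left inverse, so smoothness may be tested on values. -/
theorem contMDiffAt_alternating {k : ℕ} {f : M → V [⋀^Fin k]→L[ℝ] ℂ}
    (hf : ∀ v, ContMDiffAt I 𝓘(ℝ, ℂ) r (fun x => f x v) x₀) :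
    ContMDiffAt I 𝓘(ℝ, V [⋀^Fin k]→L[ℝ] ℂ) r f x₀ := by
  obtain ⟨T, hT⟩ := (basisEval V k).exists_leftInverse_of_injective
    (LinearMap.ker_eq_bot.2 (basisEval_injective k))
  have h1 : f = T.toContinuousLinearMap ∘ fun x => basisEval V k (f x) := by
    funext x
    exact (LinearMap.congr_fun hT (f x)).symm
  rw [h1]
  refine (ContinuousLinearMap.contMDiff _).contMDiffAt.comp x₀ ?_
  exact contMDiffAt_pi_space.2 fun s => hf _

theorem contMDiffAt_alternating_apply {k : ℕ} {f : M → V [⋀^Fin k]→L[ℝ] ℂ}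
    (hf : ContMDiffAt I 𝓘(ℝ, V [⋀^Fin k]→L[ℝ] ℂ) r f x₀) (v : Fin k → V) :
    ContMDiffAt I 𝓘(ℝ, ℂ) r (fun x => f x v) x₀ := by
  let T : (V [⋀^Fin k]→L[ℝ] ℂ) →ₗ[ℝ] ℂ :=
    { toFun := fun α => α v, map_add' := fun _ _ => rfl, map_smul' := fun _ _ => rfl }
  exact (ContinuousLinearMap.contMDiff T.toContinuousLinearMap).contMDiffAt.comp x₀ hf

theorem contMDiffAt_clm {W : Type*} [NormedAddCommGroup W] [NormedSpace ℝ W]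
    {f : M → V →L[ℝ] W} (hf : ∀ v, ContMDiffAt I 𝓘(ℝ, W) r (fun x => f x v) x₀) :
    ContMDiffAt I 𝓘(ℝ, V →L[ℝ] W) r f x₀ := by
  let b := Module.finBasis ℝ V
  have h1 : f = fun x => ∑ i, ContinuousLinearMap.smulRightL ℝ V W
      (b.coord i).toContinuousLinearMap (f x (b i)) := by
    funext x
    ext v
    conv_lhs => rw [← b.sum_repr v]
    simp only [map_sum, map_smul]
    simp [-Module.Basis.sum_repr]
  rw [h1]
  refine contMDiffAt_finsetSum fun i _ => ?_
  exact (ContinuousLinearMap.contMDiff _).contMDiffAt.comp x₀ (hf _)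

theorem contMDiffAt_alternating_comp {k : ℕ} (η : V [⋀^Fin k]→L[ℝ] ℂ) {R : M → V →L[ℝ] V}
    (hR : ContMDiffAt I 𝓘(ℝ, V →L[ℝ] V) r R x₀) :
    ContMDiffAt I 𝓘(ℝ, V [⋀^Fin k]→L[ℝ] ℂ) r
      (fun x => η.compContinuousLinearMap (R x)) x₀ := by
  refine contMDiffAt_alternating fun v => ?_
  have h1 : ContDiff ℝ r (η.toContinuousMultilinearMap : (Fin k → V) → ℂ) :=
    η.toContinuousMultilinearMap.contDiff
  have h2 : ContMDiffAt I 𝓘(ℝ, Fin k → V) r (fun x i => R x (v i)) x₀ :=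
    contMDiffAt_pi_space.2 fun i => hR.clm_apply contMDiffAt_const
  exact h1.contMDiff.contMDiffAt.comp x₀ h2

theorem contMDiffAt_mul {f g : M → ℂ} (hf : ContMDiffAt I 𝓘(ℝ, ℂ) r f x₀)
    (hg : ContMDiffAt I 𝓘(ℝ, ℂ) r g x₀) : ContMDiffAt I 𝓘(ℝ, ℂ) r (fun x => f x * g x) x₀ :=
  (contDiff_mul (𝕜 := ℝ)).contMDiff.contMDiffAt.comp x₀ (hf.prodMk_space hg)

theorem contMDiffAt_wedge {k l m : ℕ} (h : k + l = m) {a : M → V [⋀^Fin k]→L[ℝ] ℂ}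
    {b : M → V [⋀^Fin l]→L[ℝ] ℂ} (ha : ContMDiffAt I 𝓘(ℝ, V [⋀^Fin k]→L[ℝ] ℂ) r a x₀)
    (hb : ContMDiffAt I 𝓘(ℝ, V [⋀^Fin l]→L[ℝ] ℂ) r b x₀) :
    ContMDiffAt I 𝓘(ℝ, V [⋀^Fin m]→L[ℝ] ℂ) r (fun x => wedge h (a x) (b x)) x₀ := by
  refine contMDiffAt_alternating fun v => ?_
  simp only [wedge_apply, tensorMul_apply]
  exact contMDiffAt_mul contMDiffAt_const (contMDiffAt_finsetSum fun σ _ =>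
    contMDiffAt_mul contMDiffAt_const (contMDiffAt_mul (contMDiffAt_alternating_apply ha _)
      (contMDiffAt_alternating_apply hb _)))

theorem contMDiffAt_typeProj {J : M → V →L[ℝ] V} (hJ : ContMDiffAt I 𝓘(ℝ, V →L[ℝ] V) r J x₀)
    (p q : ℕ) {k : ℕ} (η : V [⋀^Fin k]→L[ℝ] ℂ) :
    ContMDiffAt I 𝓘(ℝ, V [⋀^Fin k]→L[ℝ] ℂ) r (fun x => typeProj (J x) p q η) x₀ := by
  refine contMDiffAt_alternating fun v => ?_
  unfold typeProj
  split_ifs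
  · simp only [ContinuousAlternatingMap.smul_apply, ContinuousAlternatingMap.sum_apply,
      smul_eq_mul]
    refine contMDiffAt_mul contMDiffAt_const (contMDiffAt_finsetSum fun j _ =>
      contMDiffAt_mul contMDiffAt_const ?_)
    refine contMDiffAt_alternating_apply (contMDiffAt_alternating_comp η ?_) v
    refine ContMDiffAt.add (f := fun _ => _) contMDiffAt_const ?_
    exact (ContinuousLinearMap.contMDiff ((_ : ℝ) • ContinuousLinearMap.id ℝ (V →L[ℝ] V))).contMDiffAt.comp
      x₀ hJ
  · exact contMDiffAt_const

theorem contMDiffAt_lefschetz_pow {Ω : M → V [⋀^Fin 2]→L[ℝ] ℂ}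
    (hΩ : ContMDiffAt I 𝓘(ℝ, V [⋀^Fin 2]→L[ℝ] ℂ) r Ω x₀) {α : M → MixedAlt V}
    (hα : ∀ k, ContMDiffAt I 𝓘(ℝ, V [⋀^Fin k]→L[ℝ] ℂ) r (fun x => α x k) x₀) (m k : ℕ) :
    ContMDiffAt I 𝓘(ℝ, V [⋀^Fin k]→L[ℝ] ℂ) r (fun x => (lefschetz (Ω x) ^ m) (α x) k) x₀ := by
  induction m generalizing k with
  | zero => exact hα k
  | succ m ih =>
    simp only [pow_succ', Module.End.mul_apply]
    match k with
    | 0 => exact contMDiffAt_const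
    | 1 => exact contMDiffAt_const
    | k + 2 => exact contMDiffAt_wedge _ hΩ (ih k)

/-- A solution `f` of a linear system `A x (f x) = g x` with smooth `A` and `g`, and with an
injective `A x₀`, is smooth at `x₀`. -/
theorem contMDiffAt_of_injective {W : Type*} [NormedAddCommGroup W] [NormedSpace ℝ W]
    [FiniteDimensional ℝ W] {A : M → V →L[ℝ] W} (hA : ContMDiffAt I 𝓘(ℝ, V →L[ℝ] W) r A x₀)
    (hinj : ∀ v, A x₀ v = 0 → v = 0) {f : M → V} {g : M → W}
    (hg : ContMDiffAt I 𝓘(ℝ, W) r g x₀) (hfg : ∀ᶠ x in nhds x₀, A x (f x) = g x) :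
    ContMDiffAt I 𝓘(ℝ, V) r f x₀ := by
  have : CompleteSpace V := FiniteDimensional.complete ℝ V
  -- With `S` a left inverse of `A x₀`, the endomorphism `S ∘ A x` is the identity at `x₀`, hence
  -- invertible nearby; there `f = (S ∘ A)⁻¹ (S g)`, and inversion is smooth.
  obtain ⟨T, hT⟩ := (A x₀ : V →ₗ[ℝ] W).exists_leftInverse_of_injective
    (LinearMap.ker_eq_bot'.2 hinj)
  let S : W →L[ℝ] V := T.toContinuousLinearMap
  have hS : S.comp (A x₀) = (ContinuousLinearEquiv.refl ℝ V : V →L[ℝ] V) := by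
    ext v
    exact LinearMap.congr_fun hT v
  have hSA : ContMDiffAt I 𝓘(ℝ, V →L[ℝ] V) r (fun x => S.comp (A x)) x₀ :=
    contMDiffAt_const.clm_comp hA
  have hinv : ContMDiffAt I 𝓘(ℝ, V →L[ℝ] V) r (fun x => (S.comp (A x)).inverse) x₀ := by
    refine ContMDiffAt.comp (I' := 𝓘(ℝ, V →L[ℝ] V)) x₀
      (g := ContinuousLinearMap.inverse) ?_ hSA
    rw [hS]
    exact (contDiffAt_map_inverse _).contMDiffAt
  refine (hinv.clm_apply (contMDiffAt_const.clm_apply hg : ContMDiffAt I 𝓘(ℝ, V) r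
    (fun x => S (g x)) x₀)).congr_of_eventuallyEq ?_
  have hev : ∀ᶠ x in nhds x₀, S.comp (A x) ∈
      Set.range ((↑) : (V ≃L[ℝ] V) → V →L[ℝ] V) := by
    refine hSA.continuousAt.eventually (p := (· ∈ Set.range
      ((↑) : (V ≃L[ℝ] V) → V →L[ℝ] V))) ?_
    simp only [hS]
    exact ContinuousLinearEquiv.nhds _
  filter_upwards [hev, hfg] with x ⟨u, hu⟩ hx
  rw [← hx, ← hu, ContinuousLinearMap.inverse_equiv]
  have h1 : S (A x (f x)) = u (f x) := (DFunLike.congr_fun hu (f x)).symm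
  rw [h1]
  exact (u.symm_apply_apply (f x)).symm

end SmoothFamilies

/-! ### Transport of the pointwise statements along linear isomorphisms. -/

section ChangeOfFrame

variable {V : Type*} [NormedAddCommGroup V] [NormedSpace ℝ V]

theorem pull_lefschetz_pow_comp (Ω : V [⋀^Fin 2]→L[ℝ] ℂ) (R : V →L[ℝ] V) (m : ℕ)
    (α : MixedAlt V) : pull R ((lefschetz Ω ^ m) α) =
      (lefschetz (Ω.compContinuousLinearMap R) ^ m) (pull R α) := by
  induction m with
  | zero => rfl
  | succ m ih =>
    rw [pow_succ', pow_succ', Module.End.mul_apply, Module.End.mul_apply, ← ih]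
    funext k
    match k with
    | 0 => rfl
    | 1 => rfl
    | k + 2 => exact wedge_compContinuousLinearMap _ _ _ _

theorem typeProj_compContinuousLinearMap {J J' R : V →L[ℝ] V} (h : ∀ v, R (J' v) = J (R v))
    (p q : ℕ) {k : ℕ} (α : V [⋀^Fin k]→L[ℝ] ℂ) :
    (typeProj J p q α).compContinuousLinearMap R =
      typeProj J' p q (α.compContinuousLinearMap R) := by
  have h1 : ∀ t v, R (rotation J' t v) = rotation J t (R v) := fun t v => by
    simp [rotation, h]
  unfold typeProj
  split_ifs
  · ext v
    simp [h1, Function.comp_def]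
  · ext v
    simp

theorem pull_pull (R S : V →L[ℝ] V) (α : MixedAlt V) : pull R (pull S α) = pull (S.comp R) α :=
  rfl

theorem pull_id_of {R : V →L[ℝ] V} (h : ∀ v, R v = v) (α : MixedAlt V) : pull R α = α := by
  funext k
  ext v
  simp [pull_apply, h]

theorem pull_single (R : V →L[ℝ] V) {k : ℕ} (η : V [⋀^Fin k]→L[ℝ] ℂ) :
    pull R (Pi.single k η) = Pi.single k (η.compContinuousLinearMap R) := by
  funext j
  obtain rfl | hj := eq_or_ne j k
  · rw [Pi.single_eq_same]
    ext v
    rw [pull_apply, Pi.single_eq_same]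
    rfl
  · ext v
    rw [pull_apply, Pi.single_eq_of_ne hj, Pi.single_eq_of_ne hj]
    rfl

/-- Here `*α` is a multiple of `L^{n-k} α`, so it vanishes, and `α = ±**α`. -/
theorem IsHermitian.eq_zero_of_lefschetz_pow_eq_zero {n : ℕ} {J : V →L[ℝ] V}
    {g : V →L[ℝ] V →L[ℝ] ℝ} {Ω : V [⋀^Fin 2]→L[ℝ] ℂ} {e : Fin (2 * n) → V}
    (H : IsHermitian J g Ω e) {a b : ℕ} (hab : a = 0 ∨ b = 0) (hk : a + b ≤ n)
    {α : MixedAlt V} (hα : IsOfType J a b α) (hL : (lefschetz Ω ^ (n - (a + b))) α = 0) :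
    α = 0 := by
  have h1 := H.hodge_of_isOfType hab hk hα
  rw [hL] at h1
  have h2 := H.hodge_hodge α
  have h3 : pureConst n a b • (0 : MixedAlt V) = 0 := by
    funext k
    ext v
    simp
  rw [h1, h3, map_zero] at h2
  funext k
  ext v
  have h4 := congrArg (fun f => f v) (congrFun h2 k)
  simpa [degSign_apply] using h4.symm

/-- The same injectivity read in a trivialization `R` of the tangent space. The bidegree is
expressed as being fixed by `typeProj J'`, a linear equation in `η`. -/
theorem IsHermitian.eq_zero_of_comp {n : ℕ} {J : V →L[ℝ] V}
    {g : V →L[ℝ] V →L[ℝ] ℝ} {Ω : V [⋀^Fin 2]→L[ℝ] ℂ} {e : Fin (2 * n) → V}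
    (H : IsHermitian J g Ω e) {J' R S : V →L[ℝ] V} (hRS : ∀ v, R (S v) = v)
    (hSR : ∀ v, S (R v) = v) (hJ' : ∀ v, R (J' v) = J (R v)) {a b : ℕ} (hab : a = 0 ∨ b = 0)
    (hk : a + b ≤ n) {η : V [⋀^Fin (a + b)]→L[ℝ] ℂ} (hη : typeProj J' a b η = η)
    (hL : (lefschetz (Ω.compContinuousLinearMap R) ^ (n - (a + b))) (Pi.single (a + b) η) = 0) :
    η = 0 := by
  have := H.fin
  have h1 : IsOfType J a b (Pi.single (a + b) (η.compContinuousLinearMap S)) := by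
    refine ⟨?_, fun k hk => Pi.single_eq_of_ne hk _⟩
    rw [Pi.single_eq_same, ← hη, typeProj_compContinuousLinearMap (J' := J)]
    · exact typeProj_mem H.J_J a b _
    · intro v
      rw [← hSR (J' (S v)), hJ', hRS]
  have h2 : (η.compContinuousLinearMap S).compContinuousLinearMap R = η := by
    ext v
    simp [hSR, Function.comp_def]
  have h3 := H.eq_zero_of_lefschetz_pow_eq_zero hab hk h1 (by
    rw [← pull_id_of (R := R.comp S) hRS ((lefschetz Ω ^ _) _),
      ← pull_pull, pull_lefschetz_pow_comp, pull_single, h2, hL, map_zero])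
  have h4 := congrFun h3 (a + b)
  rw [Pi.single_eq_same] at h4
  rw [← h2, h4]
  rfl

end ChangeOfFrame

/-! ### Smoothness in trivializations of the tangent bundle. -/

section Trivialization

variable {n : ℕ} {X : Type*} [TopologicalSpace X] [ChartedSpace (Model n) X]
  [IsManifold (𝓡 (2 * n)) ∞ X]

/-- The inverse of the trivialization of the tangent bundle at `x₀`. -/
def tangentFrame (x₀ x : X) : Model n →L[ℝ] Model n :=
  (trivializationAt (Model n) (TangentSpace (𝓡 (2 * n)) (M := X)) x₀).symmL ℝ x

/-- The trivialization of the tangent bundle at `x₀`. -/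
def tangentCoord (x₀ x : X) : Model n →L[ℝ] Model n :=
  (trivializationAt (Model n) (TangentSpace (𝓡 (2 * n)) (M := X)) x₀).continuousLinearMapAt ℝ x

theorem eventually_mem_baseSet (x₀ : X) : ∀ᶠ x in nhds x₀,
    x ∈ (trivializationAt (Model n) (TangentSpace (𝓡 (2 * n)) (M := X)) x₀).baseSet :=
  (trivializationAt (Model n) (TangentSpace (𝓡 (2 * n)) (M := X)) x₀).open_baseSet.mem_nhds
    (mem_baseSet_trivializationAt _ _ x₀)

theorem tangentFrame_tangentCoord {x₀ x : X} (hx : x ∈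
    (trivializationAt (Model n) (TangentSpace (𝓡 (2 * n)) (M := X)) x₀).baseSet) (v : Model n) :
    tangentFrame x₀ x (tangentCoord x₀ x v) = v :=
  Trivialization.symmL_continuousLinearMapAt _ hx v

theorem tangentCoord_tangentFrame {x₀ x : X} (hx : x ∈
    (trivializationAt (Model n) (TangentSpace (𝓡 (2 * n)) (M := X)) x₀).baseSet) (v : Model n) :
    tangentCoord x₀ x (tangentFrame x₀ x v) = v :=
  Trivialization.continuousLinearMapAt_symmL _ hx v

theorem contMDiffAt_tangentFrame (x₀ : X) (v : Model n) :
    ContMDiffAt (𝓡 (2 * n)) ((𝓡 (2 * n)).prod 𝓘(ℝ, Model n)) ∞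
      (fun x => TotalSpace.mk' (Model n) (E := TangentSpace (𝓡 (2 * n)) (M := X)) x
        (tangentFrame x₀ x v)) x₀ := by
  refine (contMDiffAt_section x₀).2 ?_
  refine (contMDiffAt_const (c := v)).congr_of_eventuallyEq ?_
  filter_upwards [eventually_mem_baseSet (n := n) x₀] with x hx
  refine Eq.trans ?_ (tangentCoord_tangentFrame hx v)
  exact (Trivialization.continuousLinearMapAt_apply_of_mem (R := ℝ)
    (trivializationAt (Model n) (TangentSpace (𝓡 (2 * n)) (M := X)) x₀) hx _).symm

/-- The expression of a form in the trivialization of the tangent bundle at `x₀`. -/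
def Form.coord {k : ℕ} (α : Form n X k) (x₀ x : X) : Model n [⋀^Fin k]→L[ℝ] ℂ :=
  ContinuousAlternatingMap.compContinuousLinearMap (M := Model n) (α x) (tangentFrame x₀ x)

theorem Form.isSmooth_iff {k : ℕ} {α : Form n X k} : α.IsSmooth ↔
    ∀ x₀, ContMDiffAt (𝓡 (2 * n)) 𝓘(ℝ, Model n [⋀^Fin k]→L[ℝ] ℂ) ∞ (α.coord x₀) x₀ := by
  refine forall_congr' fun x₀ => ?_
  rw [contMDiffAt_section]
  have : (fun x => (trivializationAt (Model n [⋀^Fin k]→L[ℝ] ℂ)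
      (fun x : X => TangentSpace (𝓡 (2 * n)) x [⋀^Fin k]→L[ℝ] Bundle.Trivial X ℂ x) x₀
        ⟨x, α x⟩).2) = α.coord x₀ := by
    funext x
    rw [FiberBundle.trivializationAt_continuousAlternatingMap_apply]
    ext v
    simp [ContinuousAlternatingMap.inCoordinates, Form.coord]
    rfl
  rw [this]

end Trivialization

end AlmostHermitian

namespace AlmostHermitianStructure

open AlmostHermitian

variable {n : ℕ} {X : Type*} [TopologicalSpace X] [ChartedSpace (Model n) X]
  [IsManifold (𝓡 (2 * n)) ∞ X] (A : AlmostHermitianStructure n X)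

/-- The almost complex structure in the trivialization of the tangent bundle at `x₀`. -/
def coordJ (x₀ x : X) : Model n →L[ℝ] Model n :=
  (tangentCoord x₀ x).comp ((A.J x : Model n →L[ℝ] Model n).comp (tangentFrame x₀ x))

theorem tangentFrame_coordJ {x₀ x : X} (hx : x ∈
    (trivializationAt (Model n) (TangentSpace (𝓡 (2 * n)) (M := X)) x₀).baseSet) (v : Model n) :
    tangentFrame x₀ x (A.coordJ x₀ x v) = A.J x (tangentFrame x₀ x v) :=
  tangentFrame_tangentCoord hx _

theorem contMDiffAt_coordJ (x₀ : X) :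
    ContMDiffAt (𝓡 (2 * n)) 𝓘(ℝ, Model n →L[ℝ] Model n) ∞ (A.coordJ x₀) x₀ := by
  have h := A.contMDiff_J x₀
  rw [contMDiffAt_section] at h
  exact h

theorem isSmooth_fundamentalForm : A.fundamentalForm.IsSmooth := by
  refine Form.isSmooth_iff.2 fun x₀ => contMDiffAt_alternating fun v => ?_
  have h1 := ContMDiffAt.clm_bundle_apply (A.contMDiff_J x₀) (contMDiffAt_tangentFrame x₀ (v 0))
  have h2 : ContMDiffAt (𝓡 (2 * n)) ((𝓡 (2 * n)).prod 𝓘(ℝ, ℝ)) ∞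
      (fun x => TotalSpace.mk' ℝ (E := Bundle.Trivial X ℝ) x
        (A.g.inner x (A.J x (tangentFrame x₀ x (v 0))) (tangentFrame x₀ x (v 1)))) x₀ := by
    apply ContMDiffAt.clm_bundle_apply₂ (F₁ := Model n) (F₂ := Model n)
    · exact A.g.contMDiff x₀
    · exact h1
    · exact contMDiffAt_tangentFrame x₀ (v 1)
  simp only [contMDiffAt_totalSpace] at h2
  exact (ContinuousLinearMap.contMDiff Complex.ofRealCLM).contMDiffAt.comp x₀ h2.2

theorem pull_tangentFrame_L_iterate (α : MixedForm n X) (m : ℕ) (x₀ x : X) :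
    pull (tangentFrame x₀ x) ((A.L^[m] α).at x) =
      (lefschetz (A.fundamentalForm.coord x₀ x) ^ m) (pull (tangentFrame x₀ x) (α.at x)) := by
  rw [at_L_iterate]
  exact pull_lefschetz_pow_comp _ _ _ _

theorem isSmooth_L_iterate {α : MixedForm n X} (hα : ∀ k, (α k).IsSmooth) (m k : ℕ) :
    (A.L^[m] α k).IsSmooth := by
  refine Form.isSmooth_iff.2 fun x₀ => ?_
  have h : (A.L^[m] α k).coord x₀ = fun x =>
      (lefschetz (A.fundamentalForm.coord x₀ x) ^ m) (pull (tangentFrame x₀ x) (α.at x)) k :=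
    funext fun x => congrFun (A.pull_tangentFrame_L_iterate α m x₀ x) k
  rw [h]
  exact contMDiffAt_lefschetz_pow (Form.isSmooth_iff.1 A.isSmooth_fundamentalForm x₀)
    (fun k => Form.isSmooth_iff.1 (hα k) x₀) m k

/-- The linear system, in the trivialization at `x₀`, whose solutions are the forms `α` of bidegree
`(a, b)` with a given `L^m α`. -/
def lefschetzSystem (a b m : ℕ) (x₀ x : X) :
    (Model n [⋀^Fin (a + b)]→L[ℝ] ℂ) →L[ℝ]
      (Model n [⋀^Fin (a + b + 2 * m)]→L[ℝ] ℂ) × (Model n [⋀^Fin (a + b)]→L[ℝ] ℂ) :=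
  LinearMap.toContinuousLinearMap
    { toFun := fun η =>
        ((lefschetz (A.fundamentalForm.coord x₀ x) ^ m) (Pi.single (a + b) η) (a + b + 2 * m),
          η - typeProj (A.coordJ x₀ x) a b η)
      map_add' := fun η η' => by
        rw [Pi.single_add, map_add, typeProj_add]
        refine Prod.ext rfl ?_
        exact add_sub_add_comm _ _ _ _
      map_smul' := fun c η => by
        have h1 : Pi.single (M := fun k => Model n [⋀^Fin k]→L[ℝ] ℂ) (a + b) (c • η) =
            (c : ℂ) • Pi.single (a + b) η := by
          rw [← Pi.single_smul]
          congr 1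
        have h2 : typeProj (A.coordJ x₀ x) a b (c • η) =
            (c : ℂ) • typeProj (A.coordJ x₀ x) a b η := typeProj_smul _ _ _ _ _
        rw [h1, map_smul, h2]
        refine Prod.ext ?_ ?_
        · ext v
          simp
        · ext v
          simp [mul_sub] }

theorem contMDiffAt_lefschetzSystem (a b m : ℕ) (x₀ : X) :
    ContMDiffAt (𝓡 (2 * n)) 𝓘(ℝ, (Model n [⋀^Fin (a + b)]→L[ℝ] ℂ) →L[ℝ]
      (Model n [⋀^Fin (a + b + 2 * m)]→L[ℝ] ℂ) × (Model n [⋀^Fin (a + b)]→L[ℝ] ℂ)) ∞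
      (A.lefschetzSystem a b m x₀) x₀ := by
  refine contMDiffAt_clm fun η => ContMDiffAt.prodMk_space ?_ ?_
  · exact contMDiffAt_lefschetz_pow (Form.isSmooth_iff.1 A.isSmooth_fundamentalForm x₀)
      (fun _ => contMDiffAt_const) m _
  · exact contMDiffAt_const.sub (contMDiffAt_typeProj (A.contMDiffAt_coordJ x₀) a b η)

theorem eq_zero_of_lefschetzSystem {a b : ℕ} (hab : a = 0 ∨ b = 0) (hk : a + b ≤ n) {x₀ : X}
    {η : Model n [⋀^Fin (a + b)]→L[ℝ] ℂ}
    (h : A.lefschetzSystem a b (n - (a + b)) x₀ x₀ η = 0) : η = 0 := by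
  have hx := mem_baseSet_trivializationAt (Model n) (TangentSpace (𝓡 (2 * n)) (M := X)) x₀
  obtain ⟨γ, hγ⟩ := lefschetz_pow_single (Ω := A.fundamentalForm.coord x₀ x₀) (n - (a + b)) η
  have h1 : (lefschetz (A.fundamentalForm.coord x₀ x₀) ^ (n - (a + b))) (Pi.single (a + b) η)
    (a + b + 2 * (n - (a + b))) = 0 := congrArg Prod.fst h
  rw [hγ, Pi.single_eq_same] at h1
  refine (A.isHermitian x₀).eq_zero_of_comp (tangentFrame_tangentCoord hx)
    (tangentCoord_tangentFrame hx) (A.tangentFrame_coordJ hx) hab hk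
    (sub_eq_zero.1 (show η - typeProj (A.coordJ x₀ x₀) a b η = 0 from congrArg Prod.snd h)).symm ?_
  refine hγ.trans ?_
  rw [h1, Pi.single_zero]

/-- In the trivialization at `x₀`, `α` solves `lefschetzSystem` with right-hand side `(L^{n-k} α,
0)`, `k = a + b`: the first equation prescribes `L^{n-k} α`, the second says that `α` has bidegree
`(a, b)`. The coefficients are smooth because `ω` and `J` are, and the system is injective at `x₀`.
-/
theorem isSmooth_of_isSmooth_L_iterate {a b : ℕ} (hab : a = 0 ∨ b = 0) (hk : a + b ≤ n)
    {α : MixedForm n X} (hα : ∀ x, IsOfType (V := Model n) (A.J x) a b (α.at x))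
    (hL : ∀ k, (A.L^[n - (a + b)] α k).IsSmooth) (k : ℕ) : (α k).IsSmooth := by
  obtain rfl | hne := eq_or_ne k (a + b)
  · refine Form.isSmooth_iff.2 fun x₀ => ?_
    refine contMDiffAt_of_injective (A.contMDiffAt_lefschetzSystem a b (n - (a + b)) x₀)
      (fun η => A.eq_zero_of_lefschetzSystem hab hk)
      (ContMDiffAt.prodMk_space (Form.isSmooth_iff.1 (hL _) x₀) (contMDiffAt_const (c := 0))) ?_
    filter_upwards [eventually_mem_baseSet (n := n) x₀] with x hx
    refine Prod.ext ?_ ?_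
    · have h1 := congrFun (A.pull_tangentFrame_L_iterate α (n - (a + b)) x₀ x)
        (a + b + 2 * (n - (a + b)))
      rw [(hα x).eq_single, pull_single] at h1
      exact h1.symm
    · change (α (a + b)).coord x₀ x - typeProj (A.coordJ x₀ x) a b ((α (a + b)).coord x₀ x) = 0
      have h1 := typeProj_compContinuousLinearMap (A.tangentFrame_coordJ hx) a b (α (a + b) x)
      have h2 := typeProj_of_mem rfl (hα x).1
      refine sub_eq_zero.2 (Eq.trans ?_ h1)
      exact congrArg (fun f => ContinuousAlternatingMap.compContinuousLinearMap (M := Model n) f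
        (tangentFrame x₀ x)) h2.symm
  · have h0 : ∀ x₀, (α k).coord x₀ = fun _ => 0 := fun x₀ => by
      funext x
      have h1 : α k x = 0 := (hα x).2 k hne
      rw [Form.coord, h1]
      rfl
    refine Form.isSmooth_iff.2 fun x₀ => ?_
    rw [h0]
    exact contMDiffAt_const

end AlmostHermitianStructure

/-! ### Harmonic forms and the correspondence by powers of `L`. -/

namespace AlmostHermitian

section Scalars

variable {n : ℕ} {X : Type*} [TopologicalSpace X] [ChartedSpace (Model n) X]

theorem smul_zero_mixedForm (c : ℂ) : c • (0 : MixedForm n X) = 0 := by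
  funext k x
  ext v
  simp

theorem smul_smul_mixedForm (c c' : ℂ) (α : MixedForm n X) : c • c' • α = (c * c') • α := by
  funext k x
  ext v
  simp [mul_assoc]

theorem sgn_of_eq_zero {k : ℕ} {α : MixedForm n X} (hα : ∀ j, j ≠ k → α j = 0) :
    sgn α = (-1 : ℂ) ^ k • α := by
  funext j
  obtain rfl | hj := eq_or_ne j k
  · rfl
  · funext x
    ext v
    simp [sgn, hα j hj]

end Scalars

end AlmostHermitian

namespace AlmostHermitianStructure

open AlmostHermitian

variable {n : ℕ} {X : Type*} [TopologicalSpace X] [ChartedSpace (Model n) X]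
  [IsManifold (𝓡 (2 * n)) ∞ X] (A : AlmostHermitianStructure n X)

theorem mem_bidegreeForms {a b : ℕ} {α : MixedForm n X} : α ∈ A.bidegreeForms a b ↔
    (∀ k, (α k).IsSmooth) ∧ ∀ x, IsOfType (V := Model n) (A.J x) a b (α.at x) :=
  and_congr_right fun _ => ⟨fun h x => ⟨h.1 x, fun k hk => congrFun (h.2 k hk) x⟩,
    fun h => ⟨fun x => (h x).1, fun k hk => funext fun x => (h x).2 k hk⟩⟩

/-- On forms of bidegree `(k, 0)` and `(0, k)` the Hodge star is a multiple of `L^(n-k)`. -/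
theorem star_of_isOfType {a b : ℕ} (hab : a = 0 ∨ b = 0) (hk : a + b ≤ n) {α : MixedForm n X}
    (hα : ∀ x, IsOfType (V := Model n) (A.J x) a b (α.at x)) :
    A.star α = pureConst n a b • A.L^[n - (a + b)] α :=
  MixedForm.ext_at fun x => by
    rw [at_star]
    refine ((A.isHermitian x).hodge_of_isOfType hab hk (hα x)).trans ?_
    rw [← at_L_iterate]
    rfl

theorem dualL_eq_zero_of_isOfType {a b : ℕ} (hab : a = 0 ∨ b = 0) (hk : a + b ≤ n)
    {α : MixedForm n X} (hα : ∀ x, IsOfType (V := Model n) (A.J x) a b (α.at x)) :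
    A.dualL α = 0 := by
  have h : A.star (A.L (A.star α)) = 0 := MixedForm.ext_at fun x => by
    rw [at_star, at_L, at_star]
    exact (A.isHermitian x).hodge_lefschetz_hodge hab hk (hα x)
  rw [dualL, h]
  funext k x
  ext v
  simp

variable {D E : MixedForm n X → MixedForm n X} {a b : ℕ}

theorem laplacian_L_iterate (hD : IsHomogeneous D) (hE : IsHomogeneous E)
    (hab : a = 0 ∨ b = 0) (hk : a + b ≤ n) {α : MixedForm n X}
    (hα : ∀ x, IsOfType (V := Model n) (A.J x) a b (α.at x)) :
    A.laplacian E D (A.L^[n - (a + b)] α) =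
      (pureConst n a b)⁻¹ • A.star (A.laplacian D E α) := by
  have hc := pureConst_ne_zero hk
  rw [← A.laplacian_star hD hE, A.star_of_isOfType hab hk hα, A.laplacian_smul hE hD hc,
    smul_smul_mixedForm, inv_mul_cancel₀ hc]
  funext k x
  ext v
  simp

/-- A form of bidegree `(n - b, n - a)`, where `a = 0` or `b = 0`, is `L^(n-a-b) α` for a multiple
`α` of its Hodge star. -/
theorem L_iterate_star (hab : a = 0 ∨ b = 0) (hk : a + b ≤ n) {β : MixedForm n X}
    (hβ : β ∈ A.bidegreeForms (n - b) (n - a)) :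
    A.L^[n - (a + b)] (((-1) ^ (n - b + (n - a)) * pureConst n a b : ℂ) • A.star β) = β := by
  have hβ' := (A.mem_bidegreeForms.1 hβ).2
  have hα : ∀ x, IsOfType (V := Model n) (A.J x) a b ((A.star β).at x) := fun x => by
    rw [at_star]
    have := (A.isHermitian x).isOfType_hodge (by omega) (by omega) (hβ' x)
    rwa [Nat.sub_sub_self (by omega), Nat.sub_sub_self (by omega)] at this
  -- Applied to `*β`, the formula for the star reads `(-1)^d β = **β = c L^{n-(a+b)} (*β)` with `d =
  -- n - b + (n - a)` the degree of `β`; multiplying by `(-1)^d` explains the constant in the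
  -- statement.
  have h1 := A.star_of_isOfType hab hk hα
  rw [A.star_star, sgn_of_eq_zero hβ.2.2] at h1
  have h2 : ∀ (c : ℂ) (α : MixedForm n X) (m : ℕ), A.L^[m] (c • α) = c • A.L^[m] α :=
    fun c α m => MixedForm.ext_at fun x => by
      rw [at_L_iterate]
      refine (map_smul (lefschetz (V := Model n) (A.fundamentalForm x) ^ m) c (α.at x)).trans ?_
      rw [← at_L_iterate]
      rfl
  rw [h2]
  funext k x
  ext v
  have h3 : (-1 : ℂ) ^ (n - b + (n - a)) * β k x v =
      pureConst n a b * A.L^[n - (a + b)] (A.star β) k x v :=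
    congrArg (fun γ : MixedForm n X => γ k x v) h1
  have h4 : ((-1 : ℂ) ^ (n - b + (n - a))) * (-1 : ℂ) ^ (n - b + (n - a)) = 1 := by
    rw [← mul_pow]
    norm_num
  change ((-1 : ℂ) ^ (n - b + (n - a)) * pureConst n a b) *
    A.L^[n - (a + b)] (A.star β) k x v = β k x v
  generalize A.L^[n - (a + b)] (A.star β) k x v = z at h3 ⊢
  generalize (-1 : ℂ) ^ (n - b + (n - a)) = s at h3 h4 ⊢
  rw [mul_assoc, ← h3, ← mul_assoc, h4, one_mul]

/-- The common form of the four identities, with `(D, E)` equal to `(∂, ∂̄)` or `(∂̄, ∂)`. The star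
exchanges the two Laplacians, and between the bidegrees `(a, b)` and `(n - b, n - a)` it is a
nonzero multiple of the power of `L`. -/
theorem harmonic_eq_image (hD : IsHomogeneous D) (hE : IsHomogeneous E)
    (hab : a = 0 ∨ b = 0) (hk : a + b ≤ n) :
    {β | β ∈ A.bidegreeForms (n - b) (n - a) ∧ A.laplacian E D β = 0} =
      A.L^[n - (a + b)] '' ({α | α ∈ A.bidegreeForms a b ∧ A.laplacian D E α = 0} ∩
        A.primitiveForms a b) := by
  ext β
  constructor
  · rintro ⟨hβ, hβ0⟩
    have hL := A.L_iterate_star hab hk hβ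
    set c : ℂ := (-1) ^ (n - b + (n - a)) * pureConst n a b with hc
    have hc0 : c ≠ 0 := mul_ne_zero (pow_ne_zero _ (by norm_num))
      (pureConst_ne_zero hk)
    have hα : ∀ x, IsOfType (V := Model n) (A.J x) a b ((c • A.star β).at x) := fun x => by
      have h1 := (A.isHermitian x).isOfType_hodge (by omega) (by omega)
        ((A.mem_bidegreeForms.1 hβ).2 x)
      rw [Nat.sub_sub_self (by omega), Nat.sub_sub_self (by omega), ← at_star] at h1
      refine ⟨Submodule.smul_mem _ c h1.1, fun k hk => ?_⟩
      have h2 := h1.2 k hk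
      ext v
      change c * (A.star β).at x k v = 0
      rw [h2]
      simp
    -- Smoothness is deduced from that of `β = L^{n-(a+b)} (c • *β)`, not from the star.
    have hmem : c • A.star β ∈ A.bidegreeForms a b :=
      A.mem_bidegreeForms.2 ⟨A.isSmooth_of_isSmooth_L_iterate hab hk hα (by
        rw [hL]
        exact hβ.1), hα⟩
    refine ⟨c • A.star β, ⟨⟨hmem, ?_⟩, hmem, A.dualL_eq_zero_of_isOfType hab hk hα⟩, hL⟩
    rw [A.laplacian_smul hD hE hc0, A.laplacian_star hE hD, hβ0, A.star_zero,
      smul_zero_mixedForm]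
  · rintro ⟨α, ⟨⟨hα, hα0⟩, -⟩, rfl⟩
    have hα' := (A.mem_bidegreeForms.1 hα).2
    refine ⟨A.mem_bidegreeForms.2 ⟨A.isSmooth_L_iterate hα.1 _, fun x => ?_⟩, ?_⟩
    · have h1 := (A.isHermitian x).isOfType_lefschetz_pow (hα' x) (n - (a + b))
      rw [← at_L_iterate, show a + (n - (a + b)) = n - b by omega,
        show b + (n - (a + b)) = n - a by omega] at h1
      exact h1
    · rw [A.laplacian_L_iterate hD hE hab hk hα', hα0, A.star_zero, smul_zero_mixedForm]

theorem harmonicDelbar_eq_image (hab : a = 0 ∨ b = 0) (hk : a + b ≤ n) :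
    A.harmonicDelbar (n - b) (n - a) =
      A.L^[n - (a + b)] '' (A.harmonicDel a b ∩ A.primitiveForms a b) :=
  A.harmonic_eq_image A.isHomogeneous_del A.isHomogeneous_delbar hab hk

theorem harmonicDel_eq_image (hab : a = 0 ∨ b = 0) (hk : a + b ≤ n) :
    A.harmonicDel (n - b) (n - a) =
      A.L^[n - (a + b)] '' (A.harmonicDelbar a b ∩ A.primitiveForms a b) :=
  A.harmonic_eq_image A.isHomogeneous_delbar A.isHomogeneous_del hab hk

end AlmostHermitianStructure
end

theorem proposition3p2 (n : ℕ) (hn : 2 ≤ n) {X : Type*} [TopologicalSpace X]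
    [ChartedSpace (AlmostHermitian.Model n) X] [IsManifold (𝓡 (2 * n)) ∞ X]
    [CompactSpace X] [T2Space X] (A : AlmostHermitianStructure n X)
    (p q : ℕ) (hp : p ≤ n) (hq : q ≤ n) :
    A.harmonicDelbar n (n - p) = A.L^[n - p] '' (A.harmonicDel p 0 ∩ A.primitiveForms p 0) ∧
    A.harmonicDelbar (n - q) n = A.L^[n - q] '' (A.harmonicDel 0 q ∩ A.primitiveForms 0 q) ∧
    A.harmonicDel n (n - p) = A.L^[n - p] '' (A.harmonicDelbar p 0 ∩ A.primitiveForms p 0) ∧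
    A.harmonicDel (n - q) n = A.L^[n - q] '' (A.harmonicDelbar 0 q ∩ A.primitiveForms 0 q) := by
  refine ⟨?_, ?_, ?_, ?_⟩
  · simpa using A.harmonicDelbar_eq_image (a := p) (b := 0) (Or.inr rfl) hp
  · simpa using A.harmonicDelbar_eq_image (a := 0) (b := q) (Or.inl rfl) (by omega)
  · simpa using A.harmonicDel_eq_image (a := p) (b := 0) (Or.inr rfl) hp
  · simpa using A.harmonicDel_eq_image (a := 0) (b := q) (Or.inl rfl) (by omega)
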